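/- Let $\mathcal H$ be a complex separable Hilbert space. For $r\ge 1$ let $\mathcal B_r(\mathcal H)$ be the $r$-Schatten class, with norm $\|x\|_r=(\mathrm{Tr}\,|x|^r)^{1/r}$, $|x|=(x^*x)^{1/2}$. Let $n\ge 1$ be an integer, $p=2n$, $\frac1p+\frac1q=1$ and $\alpha=q/2$. Let $w:\mathbb R\to\mathcal B_q(\mathcal H)$ be a $C^1$ solution of $$\dot w=|w|^q-|w^*|^q ,$$ and put $b(t)=|w(t)|^2=w(t)^*w(t)$ and $K=w(0)-w(0)^*$ (twice the skew-adjoint part of $w$, which is constant in $t$). Let $(\lambda_i)_i$ be the (finite or infinite) family of the distinct positive eigenvalues of $b(0)$, and let $p_i(t)$ be the orthogonal projection onto $\ker(b(t)-\lambda_i)$. Then: 1. For every $t$, $b(t)=\sum_i\lambda_i p_i(t)$, with convergence in $\mathcal B_1(\mathcal H)$. 2. Each $p_i$ is $C^1$ in $\mathcal B_q(\mathcal H)$ and satisfies $$\dot p_i=\lambda_i^{\alpha-1}\Big([p_i,K]-\sum_{l\ne i}\frac{\lambda_i^{1-\alpha}-\lambda_l^{1-\alpha}}{\lambda_i-\lambda_l}\,\lambda_l^{\alpha}\,\{p_iKp_l-p_lKp_i\}\Big),$$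 where $[x,y]=xy-yx$ and, for every $t$, the sum over $l$ converges in $\mathcal B_q(\mathcal H)$ and in $\mathcal B_p(\mathcal H)$. 3. The map $b$ is $C^1$ in $\mathcal B_1(\mathcal H)$ and, for every $t$, $$\dot b(t)=\sum_i\lambda_i\,\dot p_i(t),$$ with the series convergent in $\mathcal B_1(\mathcal H)$. All series are unordered sums, i.e. limits over the net of finite subsets of the index set. -/

import Mathlib

open Filter Topology
open scoped ENNReal

noncomputable section

namespace Schatten

variable {H : Type*} [NormedAddCommGroup H] [InnerProductSpace ℂ H] [CompleteSpace H]

/-- `|T| ^ r`, with `|T| = (T* T)^{1/2}`, by the continuous functional calculus. -/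
def absPow (r : ℝ) (T : H →L[ℂ] H) : H →L[ℂ] H := CFC.abs T ^ r

/-- The `[0, ∞]`-valued trace `∑ ⟨T ξ_i, ξ_i⟩` of a positive operator, along an orthonormal basis
`(ξ_i)` of `H` (the value does not depend on the basis). -/
def trace (T : H →L[ℂ] H) : ℝ≥0∞ :=
  ∑' i, ENNReal.ofReal
    (inner ℂ ((exists_hilbertBasis ℂ H).choose_spec.choose i)
      (T ((exists_hilbertBasis ℂ H).choose_spec.choose i))).re

/-- The Schatten norm `‖T‖_r = (Tr |T| ^ r) ^ (1 / r)`, with value `∞` outside the Schatten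
class. -/
def norm (r : ℝ) (T : H →L[ℂ] H) : ℝ≥0∞ := trace (absPow r T) ^ (1 / r)

/-- `T` belongs to the Schatten class `B_r(H)`. -/
def Mem (r : ℝ) (T : H →L[ℂ] H) : Prop := norm r T < ∞

/-- The (unordered) series `∑ f i` converges to `S` in `B_r(H)`. -/
def HasSumIn (r : ℝ) {ι : Type*} (f : ι → H →L[ℂ] H) (S : H →L[ℂ] H) : Prop :=
  (∀ i, Mem r (f i)) ∧ Mem r S ∧
    Tendsto (fun F : Finset ι => norm r (∑ i ∈ F, f i - S)) atTop (𝓝 0)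

/-- The curve `f` is `C¹` in `B_r(H)`, with derivative `f'`. -/
def IsC1In (r : ℝ) (f f' : ℝ → H →L[ℂ] H) : Prop :=
  (∀ t, Mem r (f t)) ∧ (∀ t, Mem r (f' t)) ∧
    (∀ t, Tendsto (fun s => norm r ((((s - t)⁻¹ : ℝ) : ℂ) • (f s - f t) - f' t)) (𝓝[≠] t) (𝓝 0)) ∧
    (∀ t, Tendsto (fun s => norm r (f' s - f' t)) (𝓝 t) (𝓝 0))

/-- `w` is a `C¹` solution, in `B_q(H)` and for all times, of `w' = |w| ^ q - |w*| ^ q`. -/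
def IsHamiltonSolution (q : ℝ) (w : ℝ → H →L[ℂ] H) : Prop :=
  IsC1In q w (fun t => absPow q (w t) - absPow q (star (w t)))

/-- The orthogonal projection onto the eigenspace `ker (T - x)`. -/
def eigenProj (T : H →L[ℂ] H) (x : ℝ) : H →L[ℂ] H :=
  (LinearMap.ker (T - (x : ℂ) • (1 : H →L[ℂ] H)).toLinearMap).starProjection

/-- `γ(x, y) = (x^{1-α} - y^{1-α}) / (x - y) * y^α`. -/
def gam (α x y : ℝ) : ℝ := (x ^ (1 - α) - y ^ (1 - α)) / (x - y) * y ^ α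

end Schatten

end

/-! Since p ≥ 2, the conjugate exponent satisfies 1 < q ≤ 2. Hence w is Hilbert-Schmidt and a =
|w|^q = b^α is trace class. The right side of the equation is self-adjoint, so w - w* = K is
constant, and |w*|^q w = w |w|^q turns the product rule for b = w*w into a Lax equation b' = [a, K].
It holds in trace norm, because products of Hilbert-Schmidt operators are controlled there
(`IsHamiltonSolution.isC1In_star_mul_self`).

The flow is isospectral. Each power of b has derivative [a, Z] with Z bounded
(`exists_tendstoTr_pow`), and such a commutator has trace zero because a is positive and trace
class. So the moments Tr b^(k+1) are constant; by Weierstrass approximation they determine Tr b f(b)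
for continuous f, hence the positive eigenvalues (`hasEigenvalue_of_moments`). Each λ_i thus has one
spectral gap valid for all times.

With R the reduced resolvent at λ_i, the gap gives the exact formula p(c) - p(b) = -p(c)(c-b)R(b) -
R(c)(c-b)p(b). So p_i is C¹ with p' = -p b' R - R b' p. Inserting b' = [b^α, K] gives p K D - D K p,
where D applies to b the divided difference of y^α at λ_i, set to 0 at λ_i itself. Writing D =
λ_i^(α-1) (1 - p - G), the operator G acts on the range of p_l by the coefficient of the statement
and kills ker b (`hasSumIn_gam`).

For ∑ λ_i p_i' the space is split into finitely many eigenspaces, ker b and a tail. The first two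
blocks reproduce those of [a, K] exactly. On the tail, ‖D_i‖ ≤ λ_i^(α-1), valid as α ≤ 1, leaves a
times a Hilbert-Schmidt operator no larger than K cut to the tail (`hasSumIn_smul_deriv`). All
limits are taken in trace norm and pass to B_q and B_p because Schatten norms decrease in the
exponent. -/

set_option linter.unusedSectionVars false

noncomputable section

namespace Schatten

variable {H : Type*} [NormedAddCommGroup H] [InnerProductSpace ℂ H] [CompleteSpace H]

/-! ### Hilbert-Schmidt norm and positive trace -/

variable (H) in
/-- The orthonormal basis along which `trace` is computed. -/
abbrev stdBasis : HilbertBasis (exists_hilbertBasis ℂ H).choose ℂ H :=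
  (exists_hilbertBasis ℂ H).choose_spec.choose

/-- The squared Hilbert-Schmidt norm. -/
def hs (T : H →L[ℂ] H) : ℝ≥0∞ := ∑' i, ‖T (stdBasis H i)‖ₑ ^ 2

lemma enorm_sq_eq_ofReal {E : Type*} [NormedAddCommGroup E] (x : E) :
    ‖x‖ₑ ^ 2 = ENNReal.ofReal (‖x‖ ^ 2) := by
  rw [← ofReal_norm, ENNReal.ofReal_pow (norm_nonneg _)]

lemma tsum_enorm_inner_sq {ι : Type*} (e : HilbertBasis ι ℂ H) (x : H) :
    ∑' i, ‖inner ℂ (e i) x‖ₑ ^ 2 = ‖x‖ₑ ^ 2 := by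
  have h := e.hasSum_inner_mul_inner x x
  have h2 : HasSum (fun i => ‖inner ℂ (e i) x‖ ^ 2) (‖x‖ ^ 2) := by
    have h3 := Complex.hasSum_re h
    convert h3 using 1
    · ext i
      rw [← inner_conj_symm x (e i), ← Complex.normSq_eq_conj_mul_self, Complex.ofReal_re,
        Complex.normSq_eq_norm_sq]
    · exact (inner_self_eq_norm_sq (𝕜 := ℂ) x).symm
  rw [enorm_sq_eq_ofReal, ← h2.tsum_eq, ENNReal.ofReal_tsum_of_nonneg (fun _ => by positivity)
    h2.summable]
  congr 1 with i
  rw [← ofReal_norm, ENNReal.ofReal_pow (norm_nonneg _)]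

/-- By Parseval both sides are the double sum of |⟨e_j, T e_i⟩|², and sums in [0, ∞] may be
exchanged. -/
lemma hs_star (T : H →L[ℂ] H) : hs (star T) = hs T := by
  simp only [hs, ← tsum_enorm_inner_sq (stdBasis H)]
  rw [ENNReal.tsum_comm]
  congr 1 with i
  congr 1 with j
  rw [ContinuousLinearMap.star_eq_adjoint, ContinuousLinearMap.adjoint_inner_right,
    ← inner_conj_symm, ← ofReal_norm, ← ofReal_norm, RCLike.norm_conj]

lemma hs_mul_le (A T : H →L[ℂ] H) : hs (A * T) ≤ ‖A‖ₑ ^ 2 * hs T := by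
  rw [hs, hs, ← ENNReal.tsum_mul_left]
  refine ENNReal.tsum_le_tsum fun i => ?_
  rw [← mul_pow]
  gcongr
  exact A.le_opENorm _

lemma hs_mul_le' (T A : H →L[ℂ] H) : hs (T * A) ≤ hs T * ‖A‖ₑ ^ 2 := by
  rw [← hs_star, star_mul, mul_comm (hs T), ← hs_star T]
  refine (hs_mul_le _ _).trans_eq ?_
  rw [← ofReal_norm, ← ofReal_norm, norm_star]

lemma hs_neg (T : H →L[ℂ] H) : hs (-T) = hs T := by simp [hs]

lemma hs_zero : hs (0 : H →L[ℂ] H) = 0 := by simp [hs]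

lemma enorm_add_sq_le {E : Type*} [NormedAddCommGroup E] (x y : E) :
    ‖x + y‖ₑ ^ 2 ≤ 2 * (‖x‖ₑ ^ 2 + ‖y‖ₑ ^ 2) := by
  calc ‖x + y‖ₑ ^ 2 ≤ (‖x‖ₑ + ‖y‖ₑ) ^ 2 := by gcongr; exact enorm_add_le x y
    _ ≤ 2 * (‖x‖ₑ ^ 2 + ‖y‖ₑ ^ 2) := by
      simp only [enorm]
      norm_cast
      have := add_sq_le (a := ‖x‖₊) (b := ‖y‖₊)
      simpa using this

lemma hs_add_le (S T : H →L[ℂ] H) : hs (S + T) ≤ 2 * (hs S + hs T) := by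
  rw [hs, hs, hs, ← ENNReal.tsum_add, ← ENNReal.tsum_mul_left]
  exact ENNReal.tsum_le_tsum fun i => enorm_add_sq_le _ _

lemma hs_sub_le (S T : H →L[ℂ] H) : hs (S - T) ≤ 2 * (hs S + hs T) := by
  rw [sub_eq_add_neg, ← hs_neg T]; exact hs_add_le _ _

/-- Parseval for T x with ⟨e_i, T x⟩ = ⟨T* e_i, x⟩, then Cauchy-Schwarz in each term. -/
lemma enorm_sq_le_hs (T : H →L[ℂ] H) : ‖T‖ₑ ^ 2 ≤ hs T := by
  rcases eq_or_ne (hs T) ⊤ with h | h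
  · simp [h]
  have key : ∀ x, ‖T x‖ ≤ √(hs T).toReal * ‖x‖ := by
    intro x
    have h1 : ‖T x‖ₑ ^ 2 ≤ hs T * ‖x‖ₑ ^ 2 := by
      rw [← hs_star, hs, ← ENNReal.tsum_mul_right, ← tsum_enorm_inner_sq (stdBasis H)]
      refine ENNReal.tsum_le_tsum fun i => ?_
      rw [← ContinuousLinearMap.adjoint_inner_left, ← mul_pow, ContinuousLinearMap.star_eq_adjoint]
      gcongr
      rw [← ofReal_norm, ← ofReal_norm, ← ofReal_norm,
        ← ENNReal.ofReal_mul (norm_nonneg _)]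
      exact ENNReal.ofReal_le_ofReal (norm_inner_le_norm _ _)
    have h2 := ENNReal.toReal_mono (by finiteness) h1
    simp only [ENNReal.toReal_mul, ENNReal.toReal_pow, toReal_enorm] at h2
    refine abs_le_of_sq_le_sq' ?_ (by positivity) |>.2
    rwa [mul_pow, Real.sq_sqrt ENNReal.toReal_nonneg]
  have h3 := T.opNorm_le_bound (Real.sqrt_nonneg _) key
  rw [← ofReal_norm, ← ENNReal.ofReal_pow (norm_nonneg _)]
  refine ENNReal.ofReal_le_of_le_toReal ?_
  calc ‖T‖ ^ 2 ≤ √(hs T).toReal ^ 2 := by gcongr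
    _ = _ := Real.sq_sqrt ENNReal.toReal_nonneg

lemma trace_star_mul_self (T : H →L[ℂ] H) : trace (star T * T) = hs T := by
  rw [trace, hs]
  congr 1 with i
  rw [enorm_sq_eq_ofReal, mul_apply_eq_comp, ContinuousLinearMap.star_eq_adjoint,
    ContinuousLinearMap.adjoint_inner_right]
  congr 1
  exact inner_self_eq_norm_sq (𝕜 := ℂ) _

lemma trace_eq_hs_sqrt {a : H →L[ℂ] H} (ha : 0 ≤ a) : trace a = hs (CFC.sqrt a) := by
  rw [← trace_star_mul_self, (CFC.sqrt_nonneg a).isSelfAdjoint.star_eq, CFC.sqrt_mul_sqrt_self a]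

lemma norm_two_sq (T : H →L[ℂ] H) : norm 2 T ^ 2 = hs T := by
  have : absPow 2 T = star T * T := by
    rw [absPow, ← CFC.abs_sq, ← CFC.rpow_natCast _ _ (CFC.abs_nonneg T)]; norm_num
  rw [norm, this, trace_star_mul_self, ← ENNReal.rpow_natCast, ← ENNReal.rpow_mul]
  norm_num

lemma norm_one_eq (T : H →L[ℂ] H) : norm 1 T = trace (CFC.abs T) := by
  rw [norm, absPow, CFC.rpow_one _ (CFC.abs_nonneg T)]; simp

lemma trace_mono {a c : H →L[ℂ] H} (h : a ≤ c) : trace a ≤ trace c := by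
  refine ENNReal.tsum_le_tsum fun i => ENNReal.ofReal_le_ofReal ?_
  have h1 := (ContinuousLinearMap.le_def a c).1 h
  have := h1.re_inner_nonneg_right (stdBasis H i)
  simpa [inner_sub_right] using this

lemma trace_smul {c : ℝ} (hc : 0 ≤ c) (a : H →L[ℂ] H) :
    trace (c • a) = ENNReal.ofReal c * trace a := by
  rw [trace, trace, ← ENNReal.tsum_mul_left]
  congr 1 with i
  rw [← ENNReal.ofReal_mul hc]
  congr 1
  rw [smul_apply, inner_smul_right_eq_smul, Complex.smul_re, smul_eq_mul]

lemma enorm_le_trace {a : H →L[ℂ] H} (ha : 0 ≤ a) : ‖a‖ₑ ≤ trace a := by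
  rw [trace_eq_hs_sqrt ha]
  refine le_trans ?_ (enorm_sq_le_hs _)
  conv_lhs => rw [← CFC.sqrt_mul_sqrt_self a ha]
  rw [sq]
  rw [← ofReal_norm, ← ofReal_norm, ← ENNReal.ofReal_mul (norm_nonneg _)]
  exact ENNReal.ofReal_le_ofReal (norm_mul_le _ _)

/-! ### Comparison of Schatten norms -/

lemma absPow_nonneg (r : ℝ) (T : H →L[ℂ] H) : 0 ≤ absPow r T := CFC.rpow_nonneg

lemma absPow_le_smul {r s : ℝ} (hr : 0 < r) (hrs : r ≤ s) (T : H →L[ℂ] H) :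
    absPow s T ≤ (‖T‖ ^ (s - r)) • absPow r T := by
  have ha := CFC.abs_nonneg T
  have hc : ∀ y : ℝ, 0 < y → ContinuousOn (fun x : ℝ => x ^ y) (spectrum ℝ (CFC.abs T)) :=
    fun y hy => (Real.continuous_rpow_const hy.le).continuousOn
  rw [absPow, absPow, CFC.rpow_eq_cfc_real ha, CFC.rpow_eq_cfc_real ha,
    ← cfc_const_mul _ _ _ (hc r hr)]
  refine cfc_mono (fun x hx => ?_) (hc s (hr.trans_le hrs)) (continuousOn_const.mul (hc r hr))
  have hx0 : 0 ≤ x := spectrum_nonneg_of_nonneg ha hx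
  have hx1 : x ≤ ‖T‖ := by
    rw [← CFC.norm_abs (a := T)]
    have := norm_apply_le_norm_cfc (fun x : ℝ => x) (CFC.abs T) hx (by fun_prop)
    rw [cfc_id' ℝ (CFC.abs T)] at this
    exact (le_abs_self x).trans this
  rcases hx0.eq_or_lt with rfl | hx0
  · rw [Real.zero_rpow (hr.trans_le hrs).ne', Real.zero_rpow hr.ne', mul_zero]
  · calc x ^ s = x ^ (s - r) * x ^ r := by rw [← Real.rpow_add hx0]; simp
      _ ≤ _ := by gcongr

lemma enorm_rpow_le_trace_absPow {r : ℝ} (hr : 0 < r) (T : H →L[ℂ] H) :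
    ‖T‖ₑ ^ r ≤ trace (absPow r T) := by
  refine le_trans (le_of_eq ?_) (enorm_le_trace (absPow_nonneg r T))
  rw [absPow, ← ofReal_norm, ← ofReal_norm, CFC.norm_rpow _ hr (CFC.abs_nonneg T),
    CFC.norm_abs, ENNReal.ofReal_rpow_of_nonneg (norm_nonneg _) hr.le]

/-- The Schatten norms decrease in the exponent. -/
lemma norm_anti {r s : ℝ} (hr : 0 < r) (hrs : r ≤ s) (T : H →L[ℂ] H) : norm s T ≤ norm r T := by
  have hs : 0 < s := hr.trans_le hrs
  -- The operator norm is at most A^(1/r), so Tr |T|^s ≤ ‖T‖^(s-r) A ≤ A^(s/r).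
  set A := trace (absPow r T) with hA
  have h1 : ‖T‖ₑ ≤ A ^ (1 / r) := by
    have := ENNReal.rpow_le_rpow (enorm_rpow_le_trace_absPow hr T) (one_div_pos.2 hr).le
    rwa [← ENNReal.rpow_mul, mul_one_div_cancel hr.ne', ENNReal.rpow_one] at this
  have h2 : trace (absPow s T) ≤ A ^ (s / r) := by
    refine (trace_mono (absPow_le_smul hr hrs T)).trans ?_
    rw [trace_smul (by positivity), ← ENNReal.ofReal_rpow_of_nonneg (norm_nonneg _)
      (sub_nonneg.2 hrs), ofReal_norm]
    calc ‖T‖ₑ ^ (s - r) * A ≤ (A ^ (1 / r)) ^ (s - r) * A := by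
          gcongr
      _ = A ^ (s / r) := by
        conv_lhs => enter [2]; rw [← ENNReal.rpow_one A]
        rw [← ENNReal.rpow_mul, ← ENNReal.rpow_add_of_nonneg _ _
          (mul_nonneg (one_div_pos.2 hr).le (sub_nonneg.2 hrs)) zero_le_one]
        congr 1
        field_simp
        ring_nf
  refine (ENNReal.rpow_le_rpow h2 (one_div_pos.2 hs).le).trans_eq ?_
  rw [← ENNReal.rpow_mul, norm]
  congr 1
  field_simp

lemma Mem.anti {r s : ℝ} (hr : 0 < r) (hrs : r ≤ s) {T : H →L[ℂ] H} (h : Mem r T) : Mem s T :=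
  (norm_anti hr hrs T).trans_lt h

/-! ### Trace norm: triangle inequality, ideal property, Cauchy-Schwarz -/

/-- An approximate polar decomposition. -/
lemma exists_approx_polar (T : H →L[ℂ] H) {ε : ℝ} (hε : 0 < ε) :
    ∃ u : H →L[ℂ] H, ‖u‖ ≤ 1 ∧ ‖star u * T - CFC.abs T‖ ≤ ε ∧ ‖T - u * CFC.abs T‖ ≤ ε := by
  set A := CFC.abs T with hA
  have hA0 : 0 ≤ A := CFC.abs_nonneg T
  have hAs : IsSelfAdjoint A := hA0.isSelfAdjoint
  have hsp : ∀ x ∈ spectrum ℝ A, 0 ≤ x := fun x hx => spectrum_nonneg_of_nonneg hA0 hx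
  -- The witness is u = T (|T| + ε)⁻¹. The absolute value only makes f continuous on all of ℝ; the
  -- spectrum of |T| is nonnegative.
  set f : ℝ → ℝ := fun x => (|x| + ε)⁻¹ with hf
  have hfc : Continuous f := by
    refine Continuous.inv₀ (by fun_prop) fun x => ?_
    positivity
  have hTT : star T * T = A * A := (CFC.abs_mul_abs T).symm
  have hfs : star (cfc f A) = cfc f A := (cfc_predicate f A).star_eq
  have hAc : A = cfc (fun x : ℝ => x) A := (cfc_id' ℝ A).symm
  have h3 : ∀ g : ℝ → ℝ, Continuous g → A * A * cfc g A = cfc (fun x => x * x * g x) A := by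
    intro g hg
    rw [cfc_mul (fun x : ℝ => x * x) g A (by fun_prop) (by fun_prop),
      cfc_mul (fun x : ℝ => x) (fun x : ℝ => x) A (by fun_prop) (by fun_prop), ← hAc]
  have hcomm : ∀ g : ℝ → ℝ, cfc g A * A = A * cfc g A := by
    intro g
    have := (cfc_commute_cfc g (fun x : ℝ => x) A).eq
    rwa [← hAc] at this
  have hnorm : ∀ g : ℝ → ℝ, Continuous g → ∀ c : ℝ, 0 ≤ c → (∀ x ∈ spectrum ℝ A, |x * g x| ≤ c) →
      ‖T * cfc g A‖ ≤ c := by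
    intro g hg c hc hgc
    refine abs_le_of_sq_le_sq' ?_ hc |>.2
    -- By the C*-identity, ‖T g(|T|)‖² is the norm of a function of |T| alone, so it is bounded
    -- pointwise on the spectrum.
    have h4 : star (T * cfc g A) * (T * cfc g A) = cfc (fun x => x * x * (g x * g x)) A := by
      rw [← h3 _ (by fun_prop), cfc_mul g g A (by fun_prop) (by fun_prop), star_mul,
        (cfc_predicate g A).star_eq]
      calc cfc g A * star T * (T * cfc g A) = cfc g A * (star T * T) * cfc g A := by noncomm_ring
        _ = (cfc g A * A) * A * cfc g A := by rw [hTT]; simp only [mul_assoc]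
        _ = A * A * (cfc g A * cfc g A) := by
          rw [hcomm, mul_assoc A, hcomm]; simp only [mul_assoc]
    rw [sq, ← CStarRing.norm_star_mul_self, h4]
    refine norm_cfc_le (by positivity) fun x hx => ?_
    have : x * x * (g x * g x) = (x * g x) ^ 2 := by ring
    rw [this, Real.norm_eq_abs, abs_pow]
    exact pow_le_pow_left₀ (abs_nonneg _) (hgc x hx) 2
  refine ⟨T * cfc f A, hnorm f hfc 1 zero_le_one fun x hx => ?_, ?_, ?_⟩
  · have := hsp x hx
    simp only [hf]
    rw [abs_of_nonneg (by positivity), abs_of_nonneg this, ← div_eq_mul_inv]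
    exact div_le_one_of_le₀ (by linarith) (by positivity)
  · have : star (T * cfc f A) * T - A = cfc (fun x => x * x * f x - x) A := by
      rw [cfc_sub _ _ A (by fun_prop) (by fun_prop), ← h3 f hfc, ← hAc, star_mul, hfs, mul_assoc,
        hTT, ← mul_assoc, hcomm, mul_assoc, hcomm, mul_assoc]
    rw [this]
    refine norm_cfc_le hε.le fun x hx => ?_
    have hx := hsp x hx
    have : x * x * f x - x = - (x * ε / (x + ε)) := by
      simp only [hf, abs_of_nonneg hx]; field_simp; ring
    rw [this, norm_neg, Real.norm_of_nonneg (by positivity), div_le_iff₀ (by positivity)]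
    nlinarith
  · have : T - T * cfc f A * A = T * cfc (fun x => 1 - f x * x) A := by
      rw [cfc_sub _ _ A (by fun_prop) (by fun_prop), cfc_mul _ _ A (by fun_prop) (by fun_prop),
        ← hAc, cfc_const_one ℝ A, mul_sub, mul_one, mul_assoc]
    rw [this]
    refine hnorm _ (by fun_prop) ε hε.le fun x hx => ?_
    have hx := hsp x hx
    have : x * (1 - f x * x) = x * ε / (x + ε) := by
      simp only [hf, abs_of_nonneg hx]; field_simp; ring
    rw [this, abs_of_nonneg (by positivity), div_le_iff₀ (by positivity)]
    nlinarith

lemma ennreal_le_of_sq_le_sq {x y : ℝ≥0∞} (h : x ^ 2 ≤ y ^ 2) : x ≤ y :=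
  not_lt.1 fun h' => (ENNReal.pow_lt_pow_left two_ne_zero h').not_ge h

lemma sum_enorm_inner_mul_le (x y : H →L[ℂ] H) (F : Finset (exists_hilbertBasis ℂ H).choose) :
    (∑ i ∈ F, ‖inner ℂ (stdBasis H i) (x (y (stdBasis H i)))‖ₑ) ^ 2 ≤ hs x * hs y := by
  have h1 : ∑ i ∈ F, ‖inner ℂ (stdBasis H i) (x (y (stdBasis H i)))‖ₑ ≤
      ∑ i ∈ F, ‖star x (stdBasis H i)‖ₑ * ‖y (stdBasis H i)‖ₑ := by
    refine Finset.sum_le_sum fun i _ => ?_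
    rw [← ContinuousLinearMap.adjoint_inner_left, ContinuousLinearMap.star_eq_adjoint,
      ← ofReal_norm, ← ofReal_norm, ← ofReal_norm, ← ENNReal.ofReal_mul (norm_nonneg _)]
    exact ENNReal.ofReal_le_ofReal (norm_inner_le_norm _ _)
  have h2 := h1.trans (ENNReal.inner_le_Lp_mul_Lq F _ _ Real.HolderConjugate.two_two)
  calc _ ≤ _ := pow_le_pow_left' h2 2
    _ = (∑ i ∈ F, ‖star x (stdBasis H i)‖ₑ ^ 2) * ∑ i ∈ F, ‖y (stdBasis H i)‖ₑ ^ 2 := by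
      rw [mul_pow, ← ENNReal.rpow_natCast, ← ENNReal.rpow_natCast, ← ENNReal.rpow_mul,
        ← ENNReal.rpow_mul]
      simp
    _ ≤ hs (star x) * hs y := by
      gcongr <;> exact ENNReal.sum_le_tsum _
    _ = _ := by rw [hs_star]

lemma norm_one_eq_hs (T : H →L[ℂ] H) : norm 1 T = hs (CFC.sqrt (CFC.abs T)) := by
  rw [norm_one_eq, trace_eq_hs_sqrt (CFC.abs_nonneg T)]

lemma sum_enorm_inner_le_add (S T : H →L[ℂ] H) {ε : ℝ} (h : ‖S - T‖ ≤ ε)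
    (F : Finset (exists_hilbertBasis ℂ H).choose) :
    ∑ i ∈ F, ‖inner ℂ (stdBasis H i) (S (stdBasis H i))‖ₑ ≤
      ∑ i ∈ F, ‖inner ℂ (stdBasis H i) (T (stdBasis H i))‖ₑ + F.card * ENNReal.ofReal ε := by
  rw [← nsmul_eq_mul, ← Finset.sum_const, ← Finset.sum_add_distrib]
  refine Finset.sum_le_sum fun i _ => ?_
  have h1 : inner ℂ (stdBasis H i) (S (stdBasis H i)) = inner ℂ (stdBasis H i) (T (stdBasis H i)) +
      inner ℂ (stdBasis H i) ((S - T) (stdBasis H i)) := by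
    rw [sub_apply, inner_sub_right]; ring
  rw [h1]
  refine (enorm_add_le _ _).trans ?_
  gcongr
  rw [← ofReal_norm]
  refine ENNReal.ofReal_le_ofReal ((norm_inner_le_norm _ _).trans ?_)
  have h2 := (S - T).le_opNorm (stdBasis H i)
  rw [(stdBasis H).orthonormal.norm_eq_one] at h2 ⊢
  linarith

lemma le_of_forall_le_add_mul {x y : ℝ≥0∞} (n : ℕ)
    (h : ∀ ε : ℝ, 0 < ε → x ≤ y + n * ENNReal.ofReal ε) : x ≤ y := by
  have : Tendsto (fun ε : ℝ => y + n * ENNReal.ofReal ε) (𝓝[>] 0) (𝓝 (y + n * ENNReal.ofReal 0)) := by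
    refine Tendsto.mono_left ?_ nhdsWithin_le_nhds
    refine tendsto_const_nhds.add (ENNReal.Tendsto.const_mul ?_ (Or.inr (by simp)))
    exact (ENNReal.continuous_ofReal.tendsto 0)
  simp only [ENNReal.ofReal_zero, mul_zero, add_zero] at this
  exact ge_of_tendsto this (eventually_nhdsWithin_of_forall fun ε hε => h ε hε)

/-- Up to a small operator-norm error T is c|T| with ‖c‖ ≤ 1. The error is paid once per element of
F, so it vanishes with ε because F is finite. For c|T| = (c s) s with s = |T|^(1/2), Cauchy-Schwarz
applies and hs s is the trace norm of T. -/
lemma sum_enorm_inner_le (u T v : H →L[ℂ] H) (F : Finset (exists_hilbertBasis ℂ H).choose) :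
    ∑ i ∈ F, ‖inner ℂ (stdBasis H i) ((u * T * v) (stdBasis H i))‖ₑ ≤
      ‖u‖ₑ * ‖v‖ₑ * norm 1 T := by
  refine le_of_forall_le_add_mul F.card fun ε hε => ?_
  have hd : 0 < ‖u‖ * ‖v‖ + 1 := by positivity
  obtain ⟨c, hc1, -, hc2⟩ := exists_approx_polar T (ε := ε / (‖u‖ * ‖v‖ + 1)) (by positivity)
  have h1 : ‖u * T * v - u * (c * CFC.abs T) * v‖ ≤ ε := by
    calc ‖u * T * v - u * (c * CFC.abs T) * v‖ = ‖u * (T - c * CFC.abs T) * v‖ := by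
          congr 1; noncomm_ring
      _ ≤ ‖u‖ * (ε / (‖u‖ * ‖v‖ + 1)) * ‖v‖ := by
          refine (norm_mul_le _ _).trans ?_
          gcongr
          refine (norm_mul_le _ _).trans ?_
          gcongr
      _ = ε * ((‖u‖ * ‖v‖) / (‖u‖ * ‖v‖ + 1)) := by ring
      _ ≤ ε * 1 := by
          gcongr
          exact div_le_one_of_le₀ (by linarith) hd.le
      _ = ε := mul_one _
  refine (sum_enorm_inner_le_add _ _ h1 F).trans ?_
  gcongr ?_ + _
  set s := CFC.sqrt (CFC.abs T)
  have h2 : u * (c * CFC.abs T) * v = (u * c * s) * (s * v) := by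
    rw [← CFC.sqrt_mul_sqrt_self (CFC.abs T) (CFC.abs_nonneg T)]; simp only [mul_assoc, s]
  have h3 := sum_enorm_inner_mul_le (u * c * s) (s * v) F
  rw [h2]
  refine ennreal_le_of_sq_le_sq (h3.trans ?_)
  rw [norm_one_eq_hs]
  have hc' : ‖u * c‖ₑ ≤ ‖u‖ₑ := by
    rw [← ofReal_norm, ← ofReal_norm]
    refine ENNReal.ofReal_le_ofReal ((norm_mul_le _ _).trans ?_)
    exact mul_le_of_le_one_right (norm_nonneg _) hc1
  calc hs (u * c * s) * hs (s * v) ≤ (‖u‖ₑ ^ 2 * hs s) * (hs s * ‖v‖ₑ ^ 2) := by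
        gcongr
        · exact (hs_mul_le _ _).trans (by gcongr)
        · exact hs_mul_le' _ _
    _ = _ := by ring

/-- Choosing u as the adjoint of the approximate polar factor brings u T close to |T|. With
`sum_enorm_inner_le` this describes the trace norm as a supremum, from which subadditivity and the
ideal property are read off. -/
lemma norm_one_le_of_forall_sum_le {T : H →L[ℂ] H} {C : ℝ≥0∞}
    (h : ∀ u : H →L[ℂ] H, ‖u‖ ≤ 1 → ∀ F : Finset (exists_hilbertBasis ℂ H).choose,
      ∑ i ∈ F, ‖inner ℂ (stdBasis H i) ((u * T) (stdBasis H i))‖ₑ ≤ C) : norm 1 T ≤ C := by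
  rw [norm_one_eq, trace, ENNReal.tsum_eq_iSup_sum]
  refine iSup_le fun F => ?_
  calc _ ≤ ∑ i ∈ F, ‖inner ℂ (stdBasis H i) (CFC.abs T (stdBasis H i))‖ₑ := by
        refine Finset.sum_le_sum fun i _ => ?_
        rw [← ofReal_norm]
        exact ENNReal.ofReal_le_ofReal (Complex.re_le_norm _)
    _ ≤ C := by
        refine le_of_forall_le_add_mul F.card fun ε hε => ?_
        obtain ⟨c, hc1, hc2, -⟩ := exists_approx_polar T hε
        refine (sum_enorm_inner_le_add _ (star c * T) (ε := ε) (by rwa [norm_sub_rev]) F).trans ?_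
        gcongr ?_ + _
        exact h (star c) (by rwa [norm_star]) F

lemma norm_one_mul_sq_le (x y : H →L[ℂ] H) : norm 1 (x * y) ^ 2 ≤ hs x * hs y := by
  have : norm 1 (x * y) ≤ (hs x * hs y) ^ (1 / 2 : ℝ) := by
    refine norm_one_le_of_forall_sum_le fun u hu F => ?_
    have h1 := sum_enorm_inner_mul_le (u * x) y F
    have h2 := ENNReal.rpow_le_rpow h1 (z := 1 / 2) (by norm_num)
    rw [← ENNReal.rpow_natCast, ← ENNReal.rpow_mul] at h2
    norm_num at h2
    refine le_trans (by simpa [mul_assoc] using h2) ?_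
    norm_num
    gcongr
    refine (hs_mul_le _ _).trans ?_
    refine mul_le_of_le_one_left' (pow_le_one' ?_ 2)
    rw [← ofReal_norm]; exact ENNReal.ofReal_le_one.2 hu
  calc _ ≤ ((hs x * hs y) ^ (1 / 2 : ℝ)) ^ 2 := pow_le_pow_left' this 2
    _ = _ := by rw [← ENNReal.rpow_natCast, ← ENNReal.rpow_mul]; simp

lemma norm_one_add_le (S T : H →L[ℂ] H) : norm 1 (S + T) ≤ norm 1 S + norm 1 T := by
  refine norm_one_le_of_forall_sum_le fun u hu F => ?_
  have hu' : ‖u‖ₑ ≤ 1 := by rw [← ofReal_norm]; exact ENNReal.ofReal_le_one.2 hu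
  have h1 : ∀ T : H →L[ℂ] H,
      ∑ i ∈ F, ‖inner ℂ (stdBasis H i) ((u * T) (stdBasis H i))‖ₑ ≤ norm 1 T := by
    intro T
    have := sum_enorm_inner_le u T 1 F
    rw [mul_one] at this
    refine this.trans (mul_le_of_le_one_left' (mul_le_one' hu' ?_))
    rw [← ofReal_norm]; exact ENNReal.ofReal_le_one.2 ContinuousLinearMap.norm_id_le
  refine le_trans ?_ (add_le_add (h1 S) (h1 T))
  rw [← Finset.sum_add_distrib]
  refine Finset.sum_le_sum fun i _ => ?_
  rw [mul_add, add_apply, inner_add_right]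
  exact enorm_add_le _ _

lemma norm_one_mul_mul_le (A T B : H →L[ℂ] H) :
    norm 1 (A * T * B) ≤ ‖A‖ₑ * ‖B‖ₑ * norm 1 T := by
  refine norm_one_le_of_forall_sum_le fun u hu F => ?_
  rw [← mul_assoc, ← mul_assoc]
  refine (sum_enorm_inner_le (u * A) T B F).trans ?_
  gcongr
  rw [← ofReal_norm, ← ofReal_norm]
  refine ENNReal.ofReal_le_ofReal ((norm_mul_le _ _).trans ?_)
  exact mul_le_of_le_one_left (norm_nonneg _) hu

lemma norm_one_star_le (T : H →L[ℂ] H) : norm 1 (star T) ≤ norm 1 T := by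
  refine norm_one_le_of_forall_sum_le fun u hu F => ?_
  have h1 := sum_enorm_inner_le 1 T (star u) F
  refine le_trans (le_of_eq ?_) (h1.trans (mul_le_of_le_one_left' (mul_le_one' ?_ ?_)))
  · refine Finset.sum_congr rfl fun i _ => ?_
    have : u * star T = star (1 * T * star u) := by simp
    rw [this, ContinuousLinearMap.star_eq_adjoint, ContinuousLinearMap.adjoint_inner_right,
      ← inner_conj_symm, ← ofReal_norm, RCLike.norm_conj, ofReal_norm]
  · rw [← ofReal_norm]; exact ENNReal.ofReal_le_one.2 ContinuousLinearMap.norm_id_le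
  · rw [← ofReal_norm, norm_star]; exact ENNReal.ofReal_le_one.2 hu

lemma enorm_one_le : ‖(1 : H →L[ℂ] H)‖ₑ ≤ 1 := by
  rw [← ofReal_norm]; exact ENNReal.ofReal_le_one.2 ContinuousLinearMap.norm_id_le

lemma norm_one_mul_le (A T : H →L[ℂ] H) : norm 1 (A * T) ≤ ‖A‖ₑ * norm 1 T := by
  have := norm_one_mul_mul_le A T 1
  rw [mul_one] at this
  refine this.trans ?_
  gcongr
  exact mul_le_of_le_one_right' enorm_one_le

lemma norm_one_mul_le' (T A : H →L[ℂ] H) : norm 1 (T * A) ≤ ‖A‖ₑ * norm 1 T := by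
  have := norm_one_mul_mul_le 1 T A
  rw [one_mul] at this
  refine this.trans ?_
  gcongr
  exact mul_le_of_le_one_left' enorm_one_le

lemma norm_one_smul_le (c : ℂ) (T : H →L[ℂ] H) : norm 1 (c • T) ≤ ‖c‖ₑ * norm 1 T := by
  have h := norm_one_mul_le (c • 1) T
  rw [smul_mul_assoc, one_mul] at h
  refine h.trans ?_
  gcongr
  rw [enorm_smul]
  exact mul_le_of_le_one_right' enorm_one_le

lemma norm_one_neg (T : H →L[ℂ] H) : norm 1 (-T) = norm 1 T := by
  rw [norm_one_eq, norm_one_eq, CFC.abs_neg]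

lemma norm_one_zero : norm 1 (0 : H →L[ℂ] H) = 0 := by
  rw [norm_one_eq]; simp [trace]

lemma norm_one_sub_le (S T : H →L[ℂ] H) : norm 1 (S - T) ≤ norm 1 S + norm 1 T := by
  rw [sub_eq_add_neg, ← norm_one_neg T]; exact norm_one_add_le _ _

lemma Mem.add {S T : H →L[ℂ] H} (hS : Mem 1 S) (hT : Mem 1 T) : Mem 1 (S + T) :=
  (norm_one_add_le S T).trans_lt (ENNReal.add_lt_top.2 ⟨hS, hT⟩)

lemma Mem.sub {S T : H →L[ℂ] H} (hS : Mem 1 S) (hT : Mem 1 T) : Mem 1 (S - T) :=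
  (norm_one_sub_le S T).trans_lt (ENNReal.add_lt_top.2 ⟨hS, hT⟩)

lemma Mem.neg {T : H →L[ℂ] H} (hT : Mem 1 T) : Mem 1 (-T) := by
  rw [Mem, norm_one_neg]; exact hT

lemma Mem.smul {T : H →L[ℂ] H} (hT : Mem 1 T) (c : ℂ) : Mem 1 (c • T) :=
  (norm_one_smul_le c T).trans_lt (ENNReal.mul_lt_top (by finiteness) hT)

lemma Mem.mul_left {T : H →L[ℂ] H} (hT : Mem 1 T) (A : H →L[ℂ] H) : Mem 1 (A * T) :=
  (norm_one_mul_le A T).trans_lt (ENNReal.mul_lt_top (by finiteness) hT)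

lemma Mem.mul_right {T : H →L[ℂ] H} (hT : Mem 1 T) (A : H →L[ℂ] H) : Mem 1 (T * A) :=
  (norm_one_mul_le' T A).trans_lt (ENNReal.mul_lt_top (by finiteness) hT)

lemma mem_mul_of_hs {x y : H →L[ℂ] H} (hx : hs x < ⊤) (hy : hs y < ⊤) : Mem 1 (x * y) := by
  have := (norm_one_mul_sq_le x y).trans_lt (ENNReal.mul_lt_top hx hy)
  rw [Mem]
  by_contra h
  simp [not_lt_top_iff.1 h] at this

lemma hs_mul_lt_top {x : H →L[ℂ] H} (hx : hs x < ⊤) (A : H →L[ℂ] H) : hs (A * x) < ⊤ :=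
  (hs_mul_le A x).trans_lt (ENNReal.mul_lt_top (by finiteness) hx)

lemma hs_mul_lt_top' {x : H →L[ℂ] H} (hx : hs x < ⊤) (A : H →L[ℂ] H) : hs (x * A) < ⊤ :=
  (hs_mul_le' x A).trans_lt (ENNReal.mul_lt_top hx (by finiteness))

lemma hs_sub_lt_top {x y : H →L[ℂ] H} (hx : hs x < ⊤) (hy : hs y < ⊤) : hs (x - y) < ⊤ :=
  (hs_sub_le x y).trans_lt (ENNReal.mul_lt_top (by finiteness) (ENNReal.add_lt_top.2 ⟨hx, hy⟩))

lemma tendsto_zero_of_sq_le {β : Type*} {l : Filter β} {f g : β → ℝ≥0∞} (hg : Tendsto g l (𝓝 0))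
    (h : ∀ s, f s ^ 2 ≤ g s) : Tendsto f l (𝓝 0) := by
  have h1 : Tendsto (fun s => g s ^ (1 / 2 : ℝ)) l (𝓝 0) := by
    have := ((ENNReal.continuous_rpow_const (y := 1 / 2)).tendsto 0).comp hg
    simpa [Function.comp_def] using this
  refine tendsto_of_tendsto_of_tendsto_of_le_of_le tendsto_const_nhds h1 (fun _ => zero_le)
    fun s => ?_
  have := ENNReal.rpow_le_rpow (h s) (z := 1 / 2) (by norm_num)
  rw [← ENNReal.rpow_natCast, ← ENNReal.rpow_mul] at this
  norm_num at this
  simpa using this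

lemma tendsto_zero_of_le {β : Type*} {l : Filter β} {f g : β → ℝ≥0∞} (hg : Tendsto g l (𝓝 0))
    (h : ∀ s, f s ≤ g s) : Tendsto f l (𝓝 0) :=
  tendsto_of_tendsto_of_tendsto_of_le_of_le tendsto_const_nhds hg (fun _ => zero_le) h

lemma tendsto_mul_zero {β : Type*} {l : Filter β} {f g : β → ℝ≥0∞} {c : ℝ≥0∞}
    (hf : Tendsto f l (𝓝 c)) (hc : c ≠ ⊤) (hg : Tendsto g l (𝓝 0)) :
    Tendsto (fun s => f s * g s) l (𝓝 0) := by
  simpa using ENNReal.Tendsto.mul hf (Or.inr (by simp)) hg (Or.inr hc)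

lemma tendsto_add_zero {β : Type*} {l : Filter β} {f g : β → ℝ≥0∞}
    (hf : Tendsto f l (𝓝 0)) (hg : Tendsto g l (𝓝 0)) :
    Tendsto (fun s => f s + g s) l (𝓝 0) := by
  simpa using hf.add hg

/-! ### Limits in trace and Hilbert-Schmidt norm; compactness -/

/-- Convergence in the trace norm. -/
def TendstoTr {β : Type*} (f : β → H →L[ℂ] H) (l : Filter β) (T : H →L[ℂ] H) : Prop :=
  Tendsto (fun s => norm 1 (f s - T)) l (𝓝 0)

/-- Convergence in the Hilbert-Schmidt norm. -/
def TendstoHS {β : Type*} (f : β → H →L[ℂ] H) (l : Filter β) (T : H →L[ℂ] H) : Prop :=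
  Tendsto (fun s => hs (f s - T)) l (𝓝 0)

section Limits

variable {β : Type*} {l : Filter β} {f g : β → H →L[ℂ] H} {S T : H →L[ℂ] H}

lemma tendsto_iff_enorm_sub : Tendsto f l (𝓝 T) ↔ Tendsto (fun s => ‖f s - T‖ₑ) l (𝓝 0) := by
  rw [tendsto_iff_edist_tendsto_0]
  simp only [edist_eq_enorm_sub]

lemma TendstoHS.tendsto (h : TendstoHS f l T) : Tendsto f l (𝓝 T) :=
  tendsto_iff_enorm_sub.2 (tendsto_zero_of_sq_le h fun _ => enorm_sq_le_hs _)

lemma tendstoTr_const (T : H →L[ℂ] H) : TendstoTr (fun _ : β => T) l T := by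
  simpa [TendstoTr, norm_one_zero] using tendsto_const_nhds

lemma tendstoHS_const (T : H →L[ℂ] H) : TendstoHS (fun _ : β => T) l T := by
  simpa [TendstoHS, hs_zero] using tendsto_const_nhds

lemma TendstoTr.add (hf : TendstoTr f l S) (hg : TendstoTr g l T) :
    TendstoTr (fun s => f s + g s) l (S + T) := by
  refine tendsto_zero_of_le (tendsto_add_zero hf hg) fun s => ?_
  rw [add_sub_add_comm]
  exact norm_one_add_le _ _

lemma TendstoTr.neg (hf : TendstoTr f l S) : TendstoTr (fun s => -f s) l (-S) := by
  refine tendsto_zero_of_le hf fun s => ?_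
  rw [← neg_sub', norm_one_neg]

lemma TendstoTr.sub (hf : TendstoTr f l S) (hg : TendstoTr g l T) :
    TendstoTr (fun s => f s - g s) l (S - T) := by
  simpa only [sub_eq_add_neg] using hf.add hg.neg

lemma TendstoTr.star (hf : TendstoTr f l S) : TendstoTr (fun s => star (f s)) l (star S) := by
  refine tendsto_zero_of_le hf fun s => ?_
  rw [← star_sub]
  exact norm_one_star_le _

lemma TendstoHS.star (hf : TendstoHS f l S) : TendstoHS (fun s => star (f s)) l (star S) := by
  refine tendsto_zero_of_le hf fun s => ?_
  rw [← star_sub, hs_star]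

lemma TendstoTr.mul_left (hg : TendstoTr g l T) (hT : Mem 1 T) (hf : Tendsto f l (𝓝 S)) :
    TendstoTr (fun s => f s * g s) l (S * T) := by
  have h1 : Tendsto (fun s => ‖f s‖ₑ) l (𝓝 ‖S‖ₑ) := (continuous_enorm.tendsto S).comp hf
  have h2 := tendsto_mul_zero h1 (by finiteness) hg
  have h3 := tendsto_mul_zero tendsto_const_nhds hT.ne (tendsto_iff_enorm_sub.1 hf)
  refine tendsto_zero_of_le (tendsto_add_zero h2 h3) fun s => ?_
  have : f s * g s - S * T = f s * (g s - T) + (f s - S) * T := by noncomm_ring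
  rw [this, mul_comm (norm 1 T)]
  exact (norm_one_add_le _ _).trans (add_le_add (norm_one_mul_le _ _) (norm_one_mul_le _ _))

lemma TendstoTr.mul_right (hg : TendstoTr g l T) (hT : Mem 1 T) (hf : Tendsto f l (𝓝 S)) :
    TendstoTr (fun s => g s * f s) l (T * S) := by
  have h1 : Tendsto (fun s => ‖f s‖ₑ) l (𝓝 ‖S‖ₑ) := (continuous_enorm.tendsto S).comp hf
  have h2 := tendsto_mul_zero h1 (by finiteness) hg
  have h3 := tendsto_mul_zero tendsto_const_nhds hT.ne (tendsto_iff_enorm_sub.1 hf)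
  refine tendsto_zero_of_le (tendsto_add_zero h2 h3) fun s => ?_
  have : g s * f s - T * S = (g s - T) * f s + T * (f s - S) := by noncomm_ring
  rw [this, mul_comm (norm 1 T)]
  exact (norm_one_add_le _ _).trans (add_le_add (norm_one_mul_le' _ _) (norm_one_mul_le' _ _))

/-- The error is (f-S)(g-T) + (f-S)T + S(g-T), each term being a product of Hilbert-Schmidt
operators. This is how regularity of w in B_q with q ≤ 2 becomes regularity of w*w in B_1. -/
lemma TendstoHS.mul (hf : TendstoHS f l S) (hg : TendstoHS g l T) (hS : hs S < ⊤) (hT : hs T < ⊤) :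
    TendstoTr (fun s => f s * g s) l (S * T) := by
  have h1 : TendstoTr (fun s => (f s - S) * (g s - T)) l 0 := by
    refine tendsto_zero_of_sq_le (tendsto_mul_zero hf (by simp) hg) fun s => ?_
    rw [sub_zero]; exact norm_one_mul_sq_le _ _
  have h2 : TendstoTr (fun s => (f s - S) * T) l 0 := by
    refine tendsto_zero_of_sq_le (tendsto_mul_zero tendsto_const_nhds hT.ne hf) fun s => ?_
    rw [sub_zero, mul_comm (hs T)]; exact norm_one_mul_sq_le _ _
  have h3 : TendstoTr (fun s => S * (g s - T)) l 0 := by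
    refine tendsto_zero_of_sq_le (tendsto_mul_zero tendsto_const_nhds hS.ne hg) fun s => ?_
    rw [sub_zero]; exact norm_one_mul_sq_le _ _
  have h4 := ((h1.add h2).add h3).add (tendstoTr_const (S * T))
  simp only [zero_add] at h4
  convert h4 using 2 with s
  noncomm_ring

end Limits

lemma HasSumIn.anti {r s : ℝ} (hr : 0 < r) (hrs : r ≤ s) {ι : Type*} {f : ι → H →L[ℂ] H}
    {S : H →L[ℂ] H} (h : HasSumIn r f S) : HasSumIn s f S :=
  ⟨fun i => (h.1 i).anti hr hrs, h.2.1.anti hr hrs,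
    tendsto_zero_of_le h.2.2 fun _ => norm_anti hr hrs _⟩

lemma IsC1In.anti {r s : ℝ} (hr : 0 < r) (hrs : r ≤ s) {f f' : ℝ → H →L[ℂ] H}
    (h : IsC1In r f f') : IsC1In s f f' :=
  ⟨fun i => (h.1 i).anti hr hrs, fun i => (h.2.1 i).anti hr hrs,
    fun t => tendsto_zero_of_le (h.2.2.1 t) fun _ => norm_anti hr hrs _,
    fun t => tendsto_zero_of_le (h.2.2.2 t) fun _ => norm_anti hr hrs _⟩

lemma Mem.hs_lt_top {T : H →L[ℂ] H} (h : Mem 2 T) : hs T < ⊤ := by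
  rw [← norm_two_sq]; exact ENNReal.pow_lt_top h

lemma tendstoHS_of_norm_two {β : Type*} {l : Filter β} {f : β → H →L[ℂ] H} {T : H →L[ℂ] H}
    (h : Tendsto (fun s => norm 2 (f s - T)) l (𝓝 0)) : TendstoHS f l T := by
  have := tendsto_mul_zero h (by simp) h
  simpa [TendstoHS, ← sq, norm_two_sq] using this

lemma summable_of_hs {T : H →L[ℂ] H} (h : hs T < ⊤) :
    Summable fun i => ‖T (stdBasis H i)‖ ^ 2 := by
  simp only [hs, enorm_sq_eq_ofReal] at h
  have := ENNReal.summable_toReal h.ne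
  simpa [ENNReal.toReal_ofReal, sq_nonneg] using this

lemma hs_eq_ofReal_tsum {T : H →L[ℂ] H} (h : hs T < ⊤) :
    hs T = ENNReal.ofReal (∑' i, ‖T (stdBasis H i)‖ ^ 2) := by
  rw [ENNReal.ofReal_tsum_of_nonneg (fun _ => by positivity) (summable_of_hs h), hs]
  simp only [enorm_sq_eq_ofReal]

/-- A bounded net that converges strongly to `0` converges to `0` in the Hilbert-Schmidt norm after
multiplication with a Hilbert-Schmidt operator. -/
lemma tendsto_hs_mul_of_strong {β : Type*} {l : Filter β} {Q : β → H →L[ℂ] H} {C : ℝ}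
    (hC : ∀ s, ‖Q s‖ ≤ C) (hQ : ∀ ξ, Tendsto (fun s => Q s ξ) l (𝓝 0)) {x : H →L[ℂ] H}
    (hx : hs x < ⊤) : Tendsto (fun s => hs (Q s * x)) l (𝓝 0) := by
  have h1 : Tendsto (fun s => ∑' i, ‖(Q s * x) (stdBasis H i)‖ ^ 2) l
      (𝓝 (∑' _ : (exists_hilbertBasis ℂ H).choose, (0 : ℝ))) := by
    refine tendsto_tsum_of_dominated_convergence
      (bound := fun i => C ^ 2 * ‖x (stdBasis H i)‖ ^ 2) ((summable_of_hs hx).mul_left _) ?_ ?_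
    · intro i
      have := (hQ (x (stdBasis H i))).norm.pow 2
      simpa using this
    · refine Eventually.of_forall fun s i => ?_
      rw [norm_pow, norm_norm, ← mul_pow]
      gcongr
      exact ((Q s).le_opNorm _).trans (mul_le_mul_of_nonneg_right (hC s) (norm_nonneg _))
  rw [tsum_zero] at h1
  have h2 := (ENNReal.continuous_ofReal.tendsto 0).comp h1
  rw [ENNReal.ofReal_zero] at h2
  refine h2.congr fun s => ?_
  exact (hs_eq_ofReal_tsum (hs_mul_lt_top hx _)).symm

/-- Hilbert-Schmidt operators are compact. -/
lemma isCompactOperator_of_hs {T : H →L[ℂ] H} (h : hs T < ⊤) : IsCompactOperator T := by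
  classical
  set e := stdBasis H
  -- Finite-rank truncations of T; their squared Hilbert-Schmidt distance to T is the tail of the
  -- series `hs T`.
  set A : Finset _ → H →L[ℂ] H := fun F =>
    ∑ i ∈ F, (ContinuousLinearMap.toSpanSingleton ℂ (T (e i))).comp (innerSL ℂ (e i)) with hA
  have h1 : ∀ F, IsCompactOperator (A F) := by
    intro F
    have : A F ∈ compactOperator (RingHom.id ℂ) H H := by
      refine Submodule.sum_mem _ fun i _ => ?_
      exact (isCompactOperator_of_locallyCompactSpace_dom (innerSL ℂ (e i))).clm_comp
        (ContinuousLinearMap.toSpanSingleton ℂ (T (e i)))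
    exact this
  have h2 : Tendsto A atTop (𝓝 T) := by
    refine TendstoHS.tendsto (T := T) ?_
    have h3 := ENNReal.tendsto_tsum_compl_atTop_zero h.ne
    refine tendsto_zero_of_le h3 fun F => ?_
    refine le_trans ?_ (tsum_subtype {x | x ∉ F} (fun i => ‖T (stdBasis H i)‖ₑ ^ 2)).ge
    refine ENNReal.tsum_le_tsum fun j => ?_
    have h4 : A F (e j) = if j ∈ F then T (e j) else 0 := by
      simp only [hA, sum_apply]
      simp [orthonormal_iff_ite.1 e.orthonormal]
    rw [sub_apply, h4]
    by_cases hj : j ∈ F <;> simp [hj, e]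
  exact isClosed_setOfPred_isCompactOperator.mem_of_tendsto h2 (Eventually.of_forall h1)

/-! ### Complex trace and cyclicity -/

/-- The complex-valued trace of a trace class operator. -/
def tr (T : H →L[ℂ] H) : ℂ := ∑' i, inner ℂ (stdBasis H i) (T (stdBasis H i))

lemma tsum_enorm_inner_le (T : H →L[ℂ] H) :
    ∑' i, ‖inner ℂ (stdBasis H i) (T (stdBasis H i))‖ₑ ≤ norm 1 T := by
  rw [ENNReal.tsum_eq_iSup_sum]
  refine iSup_le fun F => ?_
  have h := sum_enorm_inner_le 1 T 1 F
  rw [mul_one, one_mul] at h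
  exact h.trans (mul_le_of_le_one_left' (mul_le_one' enorm_one_le enorm_one_le))

lemma Mem.summable_inner {T : H →L[ℂ] H} (hT : Mem 1 T) :
    Summable fun i => inner ℂ (stdBasis H i) (T (stdBasis H i)) := by
  have h := ENNReal.summable_toReal ((tsum_enorm_inner_le T).trans_lt hT).ne
  simp only [toReal_enorm] at h
  exact h.of_norm

lemma enorm_tr_le (T : H →L[ℂ] H) : ‖tr T‖ₑ ≤ norm 1 T :=
  enorm_tsum_le_tsum_enorm.trans (tsum_enorm_inner_le T)

lemma tr_add {S T : H →L[ℂ] H} (hS : Mem 1 S) (hT : Mem 1 T) : tr (S + T) = tr S + tr T := by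
  rw [tr, tr, tr, ← hS.summable_inner.tsum_add hT.summable_inner]
  simp

lemma tr_sub {S T : H →L[ℂ] H} (hS : Mem 1 S) (hT : Mem 1 T) : tr (S - T) = tr S - tr T := by
  rw [tr, tr, tr, ← hS.summable_inner.tsum_sub hT.summable_inner]
  simp

lemma tr_smul (c : ℂ) (T : H →L[ℂ] H) : tr (c • T) = c * tr T := by
  rw [tr, tr, ← tsum_mul_left]
  simp

lemma tr_zero : tr (0 : H →L[ℂ] H) = 0 := by simp [tr]

lemma hs_smul_lt_top {x : H →L[ℂ] H} (hx : hs x < ⊤) (c : ℂ) : hs (c • x) < ⊤ := by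
  have := hs_mul_lt_top hx (c • 1)
  rwa [smul_mul_assoc, one_mul] at this

lemma hs_add_lt_top {x y : H →L[ℂ] H} (hx : hs x < ⊤) (hy : hs y < ⊤) : hs (x + y) < ⊤ :=
  (hs_add_le x y).trans_lt (ENNReal.mul_lt_top (by finiteness) (ENNReal.add_lt_top.2 ⟨hx, hy⟩))

lemma hs_I_smul (x : H →L[ℂ] H) : hs (Complex.I • x) = hs x := by
  simp only [hs, smul_apply, enorm_smul]
  simp [← ofReal_norm]

lemma hasSum_hs {x : H →L[ℂ] H} (hx : hs x < ⊤) :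
    HasSum (fun i => (‖x (stdBasis H i)‖ : ℂ) ^ 2) ((hs x).toReal : ℂ) := by
  rw [hs_eq_ofReal_tsum hx, ENNReal.toReal_ofReal (tsum_nonneg fun _ => by positivity)]
  exact_mod_cast Complex.hasSum_ofReal.2 (summable_of_hs hx).hasSum

/-- Polarization: the trace is expressed by Hilbert-Schmidt norms only, so cyclicity reduces to
their invariance under the adjoint. -/
lemma tr_star_mul {x y : H →L[ℂ] H} (hx : hs x < ⊤) (hy : hs y < ⊤) :
    tr (star x * y) = (((hs (x + y)).toReal : ℂ) - (hs (x - y)).toReal +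
      ((hs (x - Complex.I • y)).toReal - (hs (x + Complex.I • y)).toReal) * Complex.I) / 4 := by
  have hy' := hs_smul_lt_top hy Complex.I
  have h := ((((hasSum_hs (hs_add_lt_top hx hy)).sub (hasSum_hs (hs_sub_lt_top hx hy))).add
    (((hasSum_hs (hs_sub_lt_top hx hy')).sub (hasSum_hs (hs_add_lt_top hx hy'))).mul_right
      Complex.I)).div_const 4).tsum_eq
  rw [tr, ← h]
  refine tsum_congr fun i => ?_
  rw [ContinuousLinearMap.star_eq_adjoint, mul_apply_eq_comp,
    ContinuousLinearMap.adjoint_inner_right, inner_eq_sum_norm_sq_div_four]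
  simp

/-- The trace is cyclic on products of Hilbert-Schmidt operators. -/
lemma tr_mul_comm {x y : H →L[ℂ] H} (hx : hs x < ⊤) (hy : hs y < ⊤) : tr (x * y) = tr (y * x) := by
  have hx' : hs (star x) < ⊤ := by rwa [hs_star]
  have hy' : hs (star y) < ⊤ := by rwa [hs_star]
  have h1 := tr_star_mul hx' hy
  have h2 := tr_star_mul hy' hx
  rw [star_star] at h1 h2
  rw [h1, h2]
  have e1 : hs (star x + y) = hs (star y + x) := by rw [← hs_star]; simp [add_comm]
  have e2 : hs (star x - y) = hs (star y - x) := by rw [← hs_star, ← hs_neg]; simp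
  have e3 : hs (star x - Complex.I • y) = hs (star y - Complex.I • x) := by
    rw [← hs_star, ← hs_I_smul]
    simp only [star_sub, star_star, star_smul, smul_sub, smul_smul]
    rw [← hs_neg]
    simp
  have e4 : hs (star x + Complex.I • y) = hs (star y + Complex.I • x) := by
    rw [← hs_star, ← hs_I_smul]
    simp only [star_add, star_star, star_smul, smul_add, smul_smul]
    simp [add_comm]
  rw [e1, e2, e3, e4]

lemma hs_sqrt_lt_top {a : H →L[ℂ] H} (ha : 0 ≤ a) (h : trace a < ⊤) : hs (CFC.sqrt a) < ⊤ := by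
  rwa [← trace_eq_hs_sqrt ha]

/-- Z is merely bounded, so a is split as s·s with s Hilbert-Schmidt, and the two factors s are
moved around one at a time. -/
lemma tr_mul_comm_of_nonneg {a : H →L[ℂ] H} (ha : 0 ≤ a) (h : trace a < ⊤) (Z : H →L[ℂ] H) :
    tr (a * Z) = tr (Z * a) := by
  have hs1 := hs_sqrt_lt_top ha h
  conv_lhs => rw [← CFC.sqrt_mul_sqrt_self a ha, mul_assoc]
  conv_rhs => rw [← CFC.sqrt_mul_sqrt_self a ha, ← mul_assoc]
  rw [tr_mul_comm hs1 (hs_mul_lt_top' hs1 Z), mul_assoc, tr_mul_comm hs1 (hs_mul_lt_top hs1 Z)]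

lemma eq_zero_of_tr_eq_zero {a : H →L[ℂ] H} (ha : 0 ≤ a) (hm : Mem 1 a) (h : tr a = 0) : a = 0 := by
  have hp := (ContinuousLinearMap.nonneg_iff_isPositive a).1 ha
  have h1 : trace a = 0 := by
    have h2 := Complex.hasSum_re hm.summable_inner.hasSum
    have h3 : ∀ i, 0 ≤ (inner ℂ (stdBasis H i) (a (stdBasis H i))).re := fun i =>
      hp.re_inner_nonneg_right _
    rw [trace, ← ENNReal.ofReal_tsum_of_nonneg h3 h2.summable, h2.tsum_eq]
    change ENNReal.ofReal (tr a).re = 0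
    simp [h]
  have h2 := enorm_le_trace ha
  rw [h1] at h2
  simpa using h2

/-! ### Functional calculus and intertwining -/

/-- Functional calculus respects intertwining operators. -/
lemma cfc_intertwine {A B x : H →L[ℂ] H} (hA : IsSelfAdjoint A) (hB : IsSelfAdjoint B)
    (h : A * x = x * B) {f : ℝ → ℝ} (hf : Continuous f) : cfc f A * x = x * cfc f B := by
  have hpoly : ∀ P : Polynomial ℝ, Polynomial.aeval A P * x = x * Polynomial.aeval B P := by
    intro P
    induction P using Polynomial.induction_on' with
    | add p q hp hq => rw [map_add, map_add, add_mul, mul_add, hp, hq]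
    | monomial n c =>
      rw [Polynomial.aeval_monomial, Polynomial.aeval_monomial]
      have hn : A ^ n * x = x * B ^ n := by
        induction n with
        | zero => simp
        | succ n ih => rw [pow_succ, mul_assoc, h, ← mul_assoc, ih, mul_assoc, ← pow_succ]
      rw [mul_assoc, hn, ← mul_assoc, ← mul_assoc, Algebra.commutes]
  -- The interval [-M, M] contains both spectra, so a single Weierstrass polynomial approximates f
  -- on A and on B.
  set M := max ‖A‖ ‖B‖
  have hspec : ∀ C : H →L[ℂ] H, IsSelfAdjoint C → ‖C‖ ≤ M → ∀ y ∈ spectrum ℝ C,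
      y ∈ Set.Icc (-M) M := by
    intro C hC hCM y hy
    have := norm_apply_le_norm_cfc (fun x : ℝ => x) C hy (by fun_prop)
    rw [cfc_id' ℝ C] at this
    exact abs_le.1 (this.trans hCM)
  rw [← sub_eq_zero, ← norm_le_zero_iff]
  refine le_of_forall_pos_le_add fun ε hε => ?_
  have hd : 0 < 2 * ‖x‖ + 1 := by positivity
  obtain ⟨P, hP⟩ := exists_polynomial_near_of_continuousOn (-M) M f hf.continuousOn
    (ε / (2 * ‖x‖ + 1)) (by positivity)
  have key : ∀ C : H →L[ℂ] H, IsSelfAdjoint C → ‖C‖ ≤ M →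
      ‖cfc f C - Polynomial.aeval C P‖ ≤ ε / (2 * ‖x‖ + 1) := by
    intro C hC hCM
    rw [← cfc_polynomial P C, ← cfc_sub f _ C (by fun_prop) (by fun_prop)]
    refine norm_cfc_le (by positivity) fun y hy => ?_
    rw [← norm_neg, neg_sub]
    exact (hP y (hspec C hC hCM y hy)).le
  have e : cfc f A * x - x * cfc f B =
      (cfc f A - Polynomial.aeval A P) * x - x * (cfc f B - Polynomial.aeval B P) := by
    rw [sub_mul, mul_sub, hpoly]; abel
  rw [e, zero_add]
  calc _ ≤ ‖cfc f A - Polynomial.aeval A P‖ * ‖x‖ + ‖x‖ * ‖cfc f B - Polynomial.aeval B P‖ :=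
        (norm_sub_le _ _).trans (add_le_add (norm_mul_le _ _) (norm_mul_le _ _))
    _ ≤ ε / (2 * ‖x‖ + 1) * ‖x‖ + ‖x‖ * (ε / (2 * ‖x‖ + 1)) := by
        gcongr
        · exact key A hA (le_max_left _ _)
        · exact key B hB (le_max_right _ _)
    _ = ε * (2 * ‖x‖ / (2 * ‖x‖ + 1)) := by ring
    _ ≤ ε * 1 := by
        gcongr
        exact div_le_one_of_le₀ (by linarith) hd.le
    _ = ε := mul_one _

/-- The hypothesis says that x intertwines A with the scalar operator c. -/
lemma cfc_mul_of_eigen {A x : H →L[ℂ] H} (hA : IsSelfAdjoint A) {c : ℝ}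
    (h : A * x = (c : ℂ) • x) {f : ℝ → ℝ} (hf : Continuous f) :
    cfc f A * x = ((f c : ℝ) : ℂ) • x := by
  have h1 : ∀ r : ℝ, algebraMap ℝ (H →L[ℂ] H) r = (r : ℂ) • 1 := fun r => by
    rw [Algebra.algebraMap_eq_smul_one]; simp
  have hB : IsSelfAdjoint (algebraMap ℝ (H →L[ℂ] H) c) :=
    IsSelfAdjoint.algebraMap _ (IsSelfAdjoint.all c)
  have := cfc_intertwine (f := f) (x := x) hA hB (by rw [h, h1]; simp) hf
  rwa [cfc_algebraMap, h1, mul_smul_comm, mul_one] at this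

/-- `|T| ^ r` as a function of `T* T`. -/
lemma absPow_eq_cfc {r : ℝ} (hr : 0 < r) (T : H →L[ℂ] H) :
    absPow r T = cfc (fun x : ℝ => x ^ (r / 2)) (star T * T) := by
  have h0 : 0 ≤ star T * T := star_mul_self_nonneg T
  rw [absPow, CFC.abs, CFC.sqrt_eq_rpow, CFC.rpow_rpow_of_exponent_nonneg _ _ _ (by norm_num) hr.le,
    CFC.rpow_eq_cfc_real h0]
  congr! 3
  ring

/-- T intertwines T T* with T* T, hence also every continuous function of them. This produces the
Lax form of the equation for b. -/
lemma absPow_star_mul {r : ℝ} (hr : 0 < r) (T : H →L[ℂ] H) :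
    absPow r (star T) * T = T * absPow r T := by
  rw [absPow_eq_cfc hr, absPow_eq_cfc hr, star_star]
  exact cfc_intertwine (IsSelfAdjoint.mul_star_self T) (IsSelfAdjoint.star_mul_self T)
    (mul_assoc _ _ _) (Real.continuous_rpow_const (by positivity))

lemma isSelfAdjoint_absPow (r : ℝ) (T : H →L[ℂ] H) : star (absPow r T) = absPow r T :=
  (absPow_nonneg r T).isSelfAdjoint.star_eq

/-! ### Eigenprojections -/

section EigenProj

lemma mem_ker_sub_smul {b : H →L[ℂ] H} {x : ℝ} {ξ : H} :
    ξ ∈ LinearMap.ker (b - (x : ℂ) • (1 : H →L[ℂ] H)).toLinearMap ↔ b ξ = (x : ℂ) • ξ := by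
  rw [LinearMap.mem_ker]
  simp [sub_eq_zero]

lemma eigenProj_apply_eq_self_iff {b : H →L[ℂ] H} {x : ℝ} {ξ : H} :
    eigenProj b x ξ = ξ ↔ b ξ = (x : ℂ) • ξ := by
  rw [eigenProj, Submodule.starProjection_eq_self_iff, mem_ker_sub_smul]

lemma mul_eigenProj (b : H →L[ℂ] H) (x : ℝ) : b * eigenProj b x = (x : ℂ) • eigenProj b x := by
  ext ξ
  exact mem_ker_sub_smul.1 (Submodule.starProjection_apply_mem _ ξ)

lemma star_eigenProj (b : H →L[ℂ] H) (x : ℝ) : star (eigenProj b x) = eigenProj b x :=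
  (isSelfAdjoint_starProjection _).star_eq

lemma eigenProj_mul_self (b : H →L[ℂ] H) (x : ℝ) :
    eigenProj b x * eigenProj b x = eigenProj b x :=
  Submodule.isIdempotentElem_starProjection _

lemma norm_eigenProj_le (b : H →L[ℂ] H) (x : ℝ) : ‖eigenProj b x‖ ≤ 1 :=
  Submodule.starProjection_norm_le _

lemma eigenProj_mul_of_eigen {b X : H →L[ℂ] H} {x : ℝ} (h : b * X = (x : ℂ) • X) :
    eigenProj b x * X = X := by
  ext ξ
  exact eigenProj_apply_eq_self_iff.2 (congr($h ξ))

lemma eigenProj_mul {b : H →L[ℂ] H} (hb : IsSelfAdjoint b) (x : ℝ) :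
    eigenProj b x * b = (x : ℂ) • eigenProj b x := by
  have := congrArg star (mul_eigenProj b x)
  simpa [star_eigenProj, hb.star_eq] using this

lemma eigenProj_mul_eigenProj {b : H →L[ℂ] H} (hb : IsSelfAdjoint b) {x y : ℝ} (h : x ≠ y) :
    eigenProj b x * eigenProj b y = 0 := by
  have h1 : (x : ℂ) • (eigenProj b x * eigenProj b y) = (y : ℂ) • (eigenProj b x * eigenProj b y) := by
    rw [← smul_mul_assoc, ← eigenProj_mul hb, mul_assoc, mul_eigenProj, mul_smul_comm]
  rw [← sub_eq_zero, ← sub_smul, smul_eq_zero] at h1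
  refine h1.resolve_left ?_
  exact sub_ne_zero.2 (by exact_mod_cast h)

lemma hasEigenvalue_iff_eigenProj_ne_zero {b : H →L[ℂ] H} {x : ℝ} :
    Module.End.HasEigenvalue b.toLinearMap (x : ℂ) ↔ eigenProj b x ≠ 0 := by
  constructor
  · intro h h0
    obtain ⟨ξ, hξ⟩ := h.exists_hasEigenvector
    have h1 : eigenProj b x ξ = ξ := eigenProj_apply_eq_self_iff.2 hξ.apply_eq_smul
    rw [h0] at h1
    exact hξ.2 h1.symm
  · intro h
    obtain ⟨ξ, hξ⟩ : ∃ ξ, eigenProj b x ξ ≠ 0 := by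
      by_contra! h2
      exact h (by ext ξ; simpa using h2 ξ)
    refine Module.End.hasEigenvalue_of_hasEigenvector (x := eigenProj b x ξ) ⟨?_, hξ⟩
    rw [Module.End.mem_eigenspace_iff]
    exact congr($(mul_eigenProj b x) ξ)

end EigenProj

/-! ### Lax equation and isospectrality -/

section Solution

lemma hs_smul_le (c : ℂ) (T : H →L[ℂ] H) : hs (c • T) ≤ ‖c‖ₑ ^ 2 * hs T := by
  rw [hs, hs, ← ENNReal.tsum_mul_left]
  refine ENNReal.tsum_le_tsum fun i => ?_
  rw [smul_apply, enorm_smul, mul_pow]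

/-- Differentiability in the Hilbert-Schmidt norm implies continuity. -/
lemma TendstoHS.tendstoHS_nhds {f : ℝ → H →L[ℂ] H} {t : ℝ} {D : H →L[ℂ] H}
    (h : TendstoHS (fun s => (((s - t)⁻¹ : ℝ) : ℂ) • (f s - f t)) (𝓝[≠] t) D) (hD : hs D < ⊤) :
    TendstoHS f (𝓝 t) (f t) := by
  rw [TendstoHS, ← nhdsNE_sup_pure, tendsto_sup]
  constructor
  · have h1 : Tendsto (fun s : ℝ => ‖((s - t : ℝ) : ℂ)‖ₑ ^ 2) (𝓝[≠] t) (𝓝 0) := by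
      have : Continuous fun s : ℝ => ‖((s - t : ℝ) : ℂ)‖ₑ ^ 2 := by fun_prop
      have h2 := this.tendsto t
      simp only [sub_self, Complex.ofReal_zero, enorm_zero, ne_eq, OfNat.ofNat_ne_zero,
        not_false_eq_true, zero_pow] at h2
      exact h2.mono_left nhdsWithin_le_nhds
    have h3 : Tendsto (fun s => 2 * (hs ((((s - t)⁻¹ : ℝ) : ℂ) • (f s - f t) - D) + hs D))
        (𝓝[≠] t) (𝓝 (2 * (0 + hs D))) :=
      ENNReal.Tendsto.const_mul (h.add tendsto_const_nhds) (Or.inr (by simp))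
    have h4 := tendsto_mul_zero h3 (by finiteness) h1
    refine tendsto_of_tendsto_of_tendsto_of_le_of_le' tendsto_const_nhds h4
      (Eventually.of_forall fun _ => zero_le) ?_
    filter_upwards [self_mem_nhdsWithin] with s hs'
    have hst : s - t ≠ 0 := sub_ne_zero.2 hs'
    have e : f s - f t = ((s - t : ℝ) : ℂ) • ((((s - t)⁻¹ : ℝ) : ℂ) • (f s - f t)) := by
      rw [smul_smul, ← Complex.ofReal_mul, mul_inv_cancel₀ hst, Complex.ofReal_one, one_smul]
    have h5 := hs_add_le ((((s - t)⁻¹ : ℝ) : ℂ) • (f s - f t) - D) D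
    rw [sub_add_cancel] at h5
    rw [mul_comm]
    calc hs (f s - f t) = hs (((s - t : ℝ) : ℂ) • ((((s - t)⁻¹ : ℝ) : ℂ) • (f s - f t))) := by
          rw [← e]
      _ ≤ _ := (hs_smul_le _ _).trans (by gcongr)
  · rw [tendsto_pure_left]
    intro S hS
    simpa [hs_zero] using mem_of_mem_nhds hS

variable {q : ℝ} {w : ℝ → H →L[ℂ] H}

lemma IsHamiltonSolution.hs_lt_top (hw : IsHamiltonSolution q w) (hq : 1 ≤ q) (hq2 : q ≤ 2) (t : ℝ) :
    hs (w t) < ⊤ := ((hw.1 t).anti (by linarith) hq2).hs_lt_top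

lemma IsHamiltonSolution.trace_lt_top (hw : IsHamiltonSolution q w) (hq : 1 ≤ q) (t : ℝ) :
    trace (absPow q (w t)) < ⊤ := by
  have h := hw.1 t
  rw [Mem, norm] at h
  exact (ENNReal.rpow_lt_top_iff_of_pos (by positivity)).1 h

lemma mem_one_of_trace_lt_top {a : H →L[ℂ] H} (ha : 0 ≤ a) (h : trace a < ⊤) : Mem 1 a := by
  rwa [Mem, norm_one_eq, CFC.abs_of_nonneg a ha]

/-- The skew-adjoint part of a solution is constant. -/
lemma IsHamiltonSolution.sub_star_eq (hw : IsHamiltonSolution q w) (hq : 1 ≤ q) (hq2 : q ≤ 2)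
    (t : ℝ) : w t - star (w t) = w 0 - star (w 0) := by
  have hw2 := IsC1In.anti (by linarith : 0 < q) hq2 hw
  have h1 : ∀ t, HasDerivAt (fun t => w t - star (w t)) 0 t := by
    intro t
    have h := (tendstoHS_of_norm_two (hw2.2.2.1 t)).tendsto
    rw [hasDerivAt_iff_tendsto_slope]
    have h2 := h.sub ((continuous_star.tendsto _).comp h)
    -- The velocity of w is self-adjoint, so it cancels in w - w*.
    have h3 : star (absPow q (w t) - absPow q (star (w t))) =
        absPow q (w t) - absPow q (star (w t)) := by
      rw [star_sub, isSelfAdjoint_absPow, isSelfAdjoint_absPow]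
    rw [h3, sub_self] at h2
    refine h2.congr fun s => ?_
    simp only [Function.comp, slope, vsub_eq_sub, star_smul, star_sub, Complex.coe_smul, star_trivial]
    rw [← smul_sub]
    congr 1
    abel
  exact is_const_of_deriv_eq_zero (fun t => (h1 t).differentiableAt) (fun t => (h1 t).deriv) t 0

/-- The equation `b' = [b ^ α, K]`, in the trace class. -/
lemma IsHamiltonSolution.isC1In_star_mul_self (hw : IsHamiltonSolution q w) (hq : 1 ≤ q)
    (hq2 : q ≤ 2) {K : H →L[ℂ] H} (hK : ∀ t, w t - star (w t) = K) :
    IsC1In 1 (fun t => star (w t) * w t)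
      (fun t => absPow q (w t) * K - K * absPow q (w t)) := by
  have hw2 := IsC1In.anti (by linarith : 0 < q) hq2 hw
  have hwt := hw.hs_lt_top hq hq2
  have hwt' : ∀ t, hs (star (w t)) < ⊤ := fun t => by rw [hs_star]; exact hwt t
  have hw' : ∀ t, hs (absPow q (w t) - absPow q (star (w t))) < ⊤ := fun t =>
    (hw2.2.1 t).hs_lt_top
  have hsa : ∀ t, star (absPow q (w t) - absPow q (star (w t))) =
      absPow q (w t) - absPow q (star (w t)) := fun t => by
    rw [star_sub, isSelfAdjoint_absPow, isSelfAdjoint_absPow]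
  -- The right side is the product rule w'* w + w* w' with w' self-adjoint. The terms |w*|^q w and
  -- w* |w*|^q become w |w|^q and |w|^q w*, leaving [|w|^q, w - w*].
  have heq : ∀ t, absPow q (w t) * K - K * absPow q (w t) =
      (absPow q (w t) - absPow q (star (w t))) * w t +
        star (w t) * (absPow q (w t) - absPow q (star (w t))) := by
    intro t
    have h1 := absPow_star_mul (by linarith : 0 < q) (w t)
    have h2 := congrArg star h1
    rw [star_mul, star_mul, isSelfAdjoint_absPow, isSelfAdjoint_absPow] at h2
    rw [sub_mul, mul_sub, h1, h2, ← hK t]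
    noncomm_ring
  have hd : ∀ t, TendstoHS (fun s => (((s - t)⁻¹ : ℝ) : ℂ) • (w s - w t)) (𝓝[≠] t)
      (absPow q (w t) - absPow q (star (w t))) := fun t => tendstoHS_of_norm_two (hw2.2.2.1 t)
  have hc : ∀ t, TendstoHS w (𝓝 t) (w t) := fun t => (hd t).tendstoHS_nhds (hw' t)
  have hmem := fun t => Mem.add (mem_mul_of_hs (hw' t) (hwt t)) (mem_mul_of_hs (hwt' t) (hw' t))
  refine ⟨fun t => mem_mul_of_hs (hwt' t) (hwt t), fun t => ?_, fun t => ?_, fun t => ?_⟩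
  · have := hmem t
    rwa [← heq t] at this
  · have h1 := (hd t).star.mul (show TendstoHS w (𝓝[≠] t) (w t) from (hc t).mono_left
      nhdsWithin_le_nhds) (by rw [hs_star]; exact hw' t) (hwt t)
    have h2 := (tendstoHS_const (star (w t))).mul (hd t) (hwt' t) (hw' t)
    have h3 := h1.add h2
    rw [hsa, ← heq] at h3
    refine Tendsto.congr (fun s => ?_) h3
    congr 2
    simp only [star_smul, star_sub, Complex.star_def, Complex.conj_ofReal, smul_mul_assoc,
      mul_smul_comm, ← smul_add]
    congr 1
    noncomm_ring
  · simp only [heq]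
    have h0 : TendstoHS (fun t => absPow q (w t) - absPow q (star (w t))) (𝓝 t)
        (absPow q (w t) - absPow q (star (w t))) := tendstoHS_of_norm_two (hw2.2.2.2 t)
    exact (h0.mul (hc t) (hw' t) (hwt t)).add ((hc t).star.mul h0 (hwt' t) (hw' t))

/-- Difference quotients of powers of a curve with derivative `[a, K]`, where `a` commutes with the
curve, converge to a commutator with `a`. -/
lemma exists_tendstoTr_pow {b : ℝ → H →L[ℂ] H} {a K : H →L[ℂ] H} {t : ℝ}
    (hab : a * b t = b t * a) (hm : Mem 1 (a * K - K * a))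
    (h : TendstoTr (fun s => (((s - t)⁻¹ : ℝ) : ℂ) • (b s - b t)) (𝓝[≠] t) (a * K - K * a))
    (hc : Tendsto b (𝓝[≠] t) (𝓝 (b t))) (k : ℕ) :
    ∃ Z, Mem 1 (a * Z - Z * a) ∧
      TendstoTr (fun s => (((s - t)⁻¹ : ℝ) : ℂ) • (b s ^ (k + 1) - b t ^ (k + 1))) (𝓝[≠] t)
        (a * Z - Z * a) := by
  induction k with
  | zero => exact ⟨K, hm, by simpa using h⟩
  | succ k ih =>
    obtain ⟨Z, hZm, hZ⟩ := ih
    have hpow : a * b t ^ (k + 1) = b t ^ (k + 1) * a := ((show Commute a (b t) from hab).pow_right _).eq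
    -- Leibniz rule for b^(k+1) b. As a commutes with b, the factors b^(k+1) and b can be moved
    -- inside the commutators, which dictates the new Z.
    have e : a * (b t ^ (k + 1) * K + Z * b t) - (b t ^ (k + 1) * K + Z * b t) * a =
        b t ^ (k + 1) * (a * K - K * a) + (a * Z - Z * a) * b t := by
      have h1 : a * (b t ^ (k + 1) * K) = b t ^ (k + 1) * (a * K) := by
        rw [← mul_assoc, hpow, mul_assoc]
      have h2 : Z * b t * a = Z * a * b t := by rw [mul_assoc, ← hab, mul_assoc]
      rw [mul_add, add_mul, h1, h2]
      noncomm_ring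
    refine ⟨b t ^ (k + 1) * K + Z * b t, ?_, ?_⟩
    · rw [e]
      exact (hm.mul_left _).add (hZm.mul_right _)
    · rw [e]
      have h1 := (h.mul_left hm (hc.pow (k + 1))).add (hZ.mul_right hZm
        (tendsto_const_nhds (x := b t)))
      refine Tendsto.congr (fun s => ?_) h1
      congr 2
      beta_reduce
      rw [mul_smul_comm, smul_mul_assoc, ← smul_add]
      congr 1
      rw [pow_succ (b s) (k + 1), pow_succ (b t) (k + 1)]
      noncomm_ring

lemma Mem.pow_succ {T : H →L[ℂ] H} (hT : Mem 1 T) (k : ℕ) : Mem 1 (T ^ (k + 1)) := by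
  rw [_root_.pow_succ]; exact hT.mul_left _

lemma tr_commutator {a : H →L[ℂ] H} (ha : 0 ≤ a) (h : trace a < ⊤) (Z : H →L[ℂ] H) :
    tr (a * Z - Z * a) = 0 := by
  have hm := mem_one_of_trace_lt_top ha h
  rw [tr_sub (hm.mul_right Z) (hm.mul_left Z), tr_mul_comm_of_nonneg ha h, sub_self]

lemma tendsto_tr {β : Type*} {l : Filter β} {f : β → H →L[ℂ] H} {T : H →L[ℂ] H}
    (h : TendstoTr f l T) (hf : ∀ s, Mem 1 (f s)) (hT : Mem 1 T) :
    Tendsto (fun s => tr (f s)) l (𝓝 (tr T)) := by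
  rw [tendsto_iff_edist_tendsto_0]
  refine tendsto_zero_of_le h fun s => ?_
  rw [edist_eq_enorm_sub, ← tr_sub (hf s) hT]
  exact enorm_tr_le _

lemma commute_absPow_star_mul_self {r : ℝ} (hr : 0 < r) (T : H →L[ℂ] H) :
    absPow r T * (star T * T) = star T * T * absPow r T := by
  have h1 := absPow_star_mul hr T
  have h2 := congrArg star h1
  rw [star_mul, star_mul, isSelfAdjoint_absPow, isSelfAdjoint_absPow] at h2
  rw [← mul_assoc, ← h2, mul_assoc, h1, mul_assoc]

lemma IsHamiltonSolution.tendsto_star_mul_self (hw : IsHamiltonSolution q w) (hq : 1 ≤ q)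
    (hq2 : q ≤ 2) (t : ℝ) :
    Tendsto (fun t => star (w t) * w t) (𝓝 t) (𝓝 (star (w t) * w t)) := by
  have hw2 := IsC1In.anti (by linarith : 0 < q) hq2 hw
  have h := ((tendstoHS_of_norm_two (hw2.2.2.1 t)).tendstoHS_nhds (hw2.2.1 t).hs_lt_top).tendsto
  exact ((continuous_star.tendsto _).comp h).mul h

/-- The moments of `b` are constant. -/
lemma IsHamiltonSolution.tr_pow_eq (hw : IsHamiltonSolution q w) (hq : 1 ≤ q)
    (hq2 : q ≤ 2) (k : ℕ) (t s : ℝ) :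
    tr ((star (w t) * w t) ^ (k + 1)) = tr ((star (w s) * w s) ^ (k + 1)) := by
  have hb := hw.isC1In_star_mul_self hq hq2 (hw.sub_star_eq hq hq2)
  have h1 : ∀ t, HasDerivAt (fun t => tr ((star (w t) * w t) ^ (k + 1))) 0 t := by
    intro t
    rw [hasDerivAt_iff_tendsto_slope]
    have hcont := (hw.tendsto_star_mul_self hq hq2 t).mono_left (nhdsWithin_le_nhds (s := {t}ᶜ))
    obtain ⟨Z, hZm, hZ⟩ := exists_tendstoTr_pow (b := fun t => star (w t) * w t)
      (commute_absPow_star_mul_self (by linarith : 0 < q) (w t)) (hb.2.1 t) (hb.2.2.1 t)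
      hcont k
    have h2 := tendsto_tr hZ (fun s => (((hb.1 s).pow_succ k).sub ((hb.1 t).pow_succ k)).smul _) hZm
    rw [tr_commutator (absPow_nonneg q _) (hw.trace_lt_top hq t)] at h2
    refine h2.congr fun s => ?_
    rw [tr_smul, tr_sub ((hb.1 s).pow_succ k) ((hb.1 t).pow_succ k)]
    simp [slope]
  exact is_const_of_deriv_eq_zero (fun t => (h1 t).differentiableAt) (fun t => (h1 t).deriv) t s

/-- The extra factor b keeps the operator trace class even when the polynomial has a constant term.
-/
lemma tr_mul_aeval_eq {b c : H →L[ℂ] H} (hb : Mem 1 b) (hc : Mem 1 c)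
    (h : ∀ k : ℕ, tr (b ^ (k + 1)) = tr (c ^ (k + 1))) (P : Polynomial ℝ) :
    tr (b * Polynomial.aeval b P) = tr (c * Polynomial.aeval c P) := by
  induction P using Polynomial.induction_on' with
  | add P Q hP hQ =>
    rw [map_add, map_add, mul_add, mul_add, tr_add (hb.mul_right _) (hb.mul_right _),
      tr_add (hc.mul_right _) (hc.mul_right _), hP, hQ]
  | monomial n r =>
    have : ∀ d : H →L[ℂ] H, d * Polynomial.aeval d (Polynomial.monomial n r) =
        (r : ℂ) • d ^ (n + 1) := by
      intro d
      rw [Polynomial.aeval_monomial, Algebra.algebraMap_eq_smul_one, smul_mul_assoc, one_mul,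
        mul_smul_comm, ← _root_.pow_succ', Complex.coe_smul]
    rw [this, this, tr_smul, tr_smul, h]

/-- Weierstrass approximation on an interval containing both spectra, using that |tr (d g(d))| is at
most ‖g(d)‖ times the trace norm of d. -/
lemma tr_mul_cfc_eq {b c : H →L[ℂ] H} (hb : Mem 1 b) (hc : Mem 1 c) (hbs : IsSelfAdjoint b)
    (hcs : IsSelfAdjoint c) (h : ∀ k : ℕ, tr (b ^ (k + 1)) = tr (c ^ (k + 1))) {f : ℝ → ℝ}
    (hf : Continuous f) : tr (b * cfc f b) = tr (c * cfc f c) := by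
  set M := max ‖b‖ ‖c‖
  have hN : 0 < (norm 1 b).toReal + (norm 1 c).toReal + 1 := by positivity
  rw [← sub_eq_zero, ← norm_le_zero_iff]
  refine le_of_forall_pos_le_add fun ε hε => ?_
  set δ := ε / ((norm 1 b).toReal + (norm 1 c).toReal + 1) with hδ
  have hδ0 : 0 < δ := by positivity
  obtain ⟨P, hP⟩ := exists_polynomial_near_of_continuousOn (-M) M f hf.continuousOn δ hδ0
  have key : ∀ d : H →L[ℂ] H, Mem 1 d → IsSelfAdjoint d → ‖d‖ ≤ M →
      ‖tr (d * cfc f d) - tr (d * Polynomial.aeval d P)‖ ≤ δ * (norm 1 d).toReal := by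
    intro d hd hds hdM
    rw [← tr_sub (hd.mul_right _) (hd.mul_right _), ← mul_sub, ← cfc_polynomial P d,
      ← cfc_sub f _ d (by fun_prop) (by fun_prop)]
    have h1 : ‖cfc (fun x => f x - Polynomial.eval x P) d‖ ≤ δ := by
      refine norm_cfc_le hδ0.le fun y hy => ?_
      rw [← norm_neg, neg_sub]
      have := norm_apply_le_norm_cfc (fun x : ℝ => x) d hy (by fun_prop)
      rw [cfc_id' ℝ d] at this
      exact (hP y (abs_le.1 (this.trans hdM))).le
    have h2 := (enorm_tr_le _).trans (norm_one_mul_le' d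
      (cfc (fun x => f x - Polynomial.eval x P) d))
    have h3 := ENNReal.toReal_mono (ENNReal.mul_lt_top (by finiteness) hd).ne h2
    rw [toReal_enorm, ENNReal.toReal_mul, toReal_enorm] at h3
    exact h3.trans (by gcongr)
  have h1 := key b hb hbs (le_max_left _ _)
  have h2 := key c hc hcs (le_max_right _ _)
  rw [tr_mul_aeval_eq hb hc h P] at h1
  have h3 := norm_sub_le_norm_sub_add_norm_sub (tr (b * cfc f b)) (tr (c * Polynomial.aeval c P))
    (tr (c * cfc f c))
  rw [norm_sub_rev (tr (c * Polynomial.aeval c P))] at h3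
  have h4 : δ * ((norm 1 b).toReal + (norm 1 c).toReal + 1) = ε := by rw [hδ]; field_simp
  linarith

lemma mem_spectrum_real_iff {b : H →L[ℂ] H} {x : ℝ} : x ∈ spectrum ℝ b ↔ (x : ℂ) ∈ spectrum ℂ b :=
  (spectrum.algebraMap_mem_iff ℂ).symm

/-- The nonzero eigenvalues of a positive trace class operator are determined by its moments. -/
lemma hasEigenvalue_of_moments {b c : H →L[ℂ] H} (hb : Mem 1 b) (hc : Mem 1 c) (hb0 : 0 ≤ b)
    (hc0 : 0 ≤ c) (hcc : IsCompactOperator c)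
    (h : ∀ k : ℕ, tr (b ^ (k + 1)) = tr (c ^ (k + 1))) {x : ℝ} (hx : 0 < x)
    (hbx : Module.End.HasEigenvalue b.toLinearMap (x : ℂ)) :
    Module.End.HasEigenvalue c.toLinearMap (x : ℂ) := by
  rw [hcc.hasEigenvalue_iff_mem_spectrum (by exact_mod_cast hx.ne'), ← mem_spectrum_real_iff]
  by_contra hcx
  obtain ⟨ε, hε, hball⟩ := Metric.isOpen_iff.1 (spectrum.isClosed c (𝕜 := ℝ)).isOpen_compl x hcx
  -- A bump at x vanishing on the spectrum of c. Then c f(c) = 0, so the positive operator b f(b)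
  -- has trace zero and must vanish, although it acts on the x-eigenspace of b as x ε > 0.
  set f : ℝ → ℝ := fun y => max 0 (ε - |y - x|) with hf
  have hfc : Continuous f := by fun_prop
  have h1 : cfc f c = 0 := by
    rw [← cfc_zero ℝ c]
    refine cfc_congr fun y hy => ?_
    have : y ∉ Metric.ball x ε := fun hy' => hball hy' hy
    rw [Metric.mem_ball, Real.dist_eq, not_lt] at this
    simpa [hf] using this
  have h2 := tr_mul_cfc_eq hb hc hb0.isSelfAdjoint hc0.isSelfAdjoint h hfc
  rw [h1, mul_zero, tr_zero] at h2
  have h3 : b * cfc f b = cfc (fun y => y * f y) b := by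
    rw [cfc_mul _ _ b (by fun_prop) (by fun_prop), cfc_id' ℝ b]
  have h4 : b * cfc f b = 0 := by
    refine eq_zero_of_tr_eq_zero ?_ (hb.mul_right _) h2
    rw [h3]
    exact cfc_nonneg fun y hy => mul_nonneg (spectrum_nonneg_of_nonneg hb0 hy) (le_max_left _ _)
  rw [h3] at h4
  have h5 := cfc_mul_of_eigen hb0.isSelfAdjoint (mul_eigenProj b x)
    (show Continuous fun y => y * f y by fun_prop)
  rw [h4, zero_mul] at h5
  rw [hasEigenvalue_iff_eigenProj_ne_zero] at hbx
  have h6 := (smul_eq_zero.1 h5.symm).resolve_right hbx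
  simp [hf, hx.ne', hε.ne', hε.le] at h6

/-- A solution is isospectral. -/
lemma IsHamiltonSolution.hasEigenvalue_iff (hw : IsHamiltonSolution q w) (hq : 1 ≤ q)
    (hq2 : q ≤ 2) {x : ℝ} (hx : 0 < x) (t s : ℝ) :
    Module.End.HasEigenvalue (star (w t) * w t).toLinearMap (x : ℂ) ↔
      Module.End.HasEigenvalue (star (w s) * w s).toLinearMap (x : ℂ) := by
  have hwt := hw.hs_lt_top hq hq2
  have hm : ∀ t, Mem 1 (star (w t) * w t) := fun t =>
    mem_mul_of_hs (by rw [hs_star]; exact hwt t) (hwt t)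
  have hcomp : ∀ t, IsCompactOperator (star (w t) * w t) := fun t =>
    (isCompactOperator_of_hs (hwt t)).clm_comp (star (w t))
  exact ⟨hasEigenvalue_of_moments (hm t) (hm s) (star_mul_self_nonneg _) (star_mul_self_nonneg _)
      (hcomp s) (fun k => hw.tr_pow_eq hq hq2 k t s) hx,
    hasEigenvalue_of_moments (hm s) (hm t) (star_mul_self_nonneg _) (star_mul_self_nonneg _)
      (hcomp t) (fun k => hw.tr_pow_eq hq hq2 k s t) hx⟩

end Solution

/-! ### Reduced resolvents and smoothness of spectral projections -/

section ReducedResolvent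

/-- A continuous function that is `1 / (y - x)` at distance at least `δ` from `x`, and `0` at `x`. -/
def redFun (δ x y : ℝ) : ℝ := (y - x) / max (δ ^ 2) ((y - x) ^ 2)

lemma continuous_redFun {δ : ℝ} (hδ : 0 < δ) (x : ℝ) : Continuous (redFun δ x) := by
  unfold redFun
  refine Continuous.div (by fun_prop) (by fun_prop) fun y => ?_
  have : 0 < δ ^ 2 := by positivity
  exact (this.trans_le (le_max_left _ _)).ne'

lemma redFun_self (δ x : ℝ) : redFun δ x x = 0 := by simp [redFun]

lemma redFun_of_le {δ x y : ℝ} (hδ : 0 < δ) (h : δ ≤ |y - x|) : redFun δ x y = (y - x)⁻¹ := by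
  have h0 : y - x ≠ 0 := abs_pos.1 (hδ.trans_le h)
  have h1 : δ ^ 2 ≤ (y - x) ^ 2 := by rw [← sq_abs (y - x)]; gcongr
  rw [redFun, max_eq_right h1]
  field_simp

/-- The reduced resolvent of `b` at `x`, if `x` is at distance at least `δ` from the other points
of the spectrum of `b`. -/
def redRes (δ x : ℝ) (b : H →L[ℂ] H) : H →L[ℂ] H := cfc (redFun δ x) b

/-- The points of the spectrum of `b` other than `x` have distance at least `δ` from `x`. -/
def IsGap (δ x : ℝ) (b : H →L[ℂ] H) : Prop := ∀ y ∈ spectrum ℝ b, y = x ∨ δ ≤ |y - x|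

variable {δ x : ℝ} {b : H →L[ℂ] H}

lemma star_redRes : star (redRes δ x b) = redRes δ x b :=
  (cfc_predicate (redFun δ x) b).star_eq

lemma norm_redRes_le (hδ : 0 < δ) (hg : IsGap δ x b) : ‖redRes δ x b‖ ≤ δ⁻¹ := by
  refine norm_cfc_le (by positivity) fun y hy => ?_
  rcases hg y hy with rfl | h
  · rw [redFun_self, norm_zero]; positivity
  · rw [redFun_of_le hδ h, norm_inv, Real.norm_eq_abs]
    gcongr

lemma redRes_mul_eigenProj (hδ : 0 < δ) (hb : IsSelfAdjoint b) :
    redRes δ x b * eigenProj b x = 0 := by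
  rw [redRes, cfc_mul_of_eigen hb (mul_eigenProj b x) (continuous_redFun hδ x), redFun_self]
  simp

lemma eigenProj_mul_redRes (hδ : 0 < δ) (hb : IsSelfAdjoint b) :
    eigenProj b x * redRes δ x b = 0 := by
  have := congrArg star (redRes_mul_eigenProj (x := x) hδ hb)
  simpa [star_redRes, star_eigenProj] using this

lemma sub_smul_eq_cfc (hb : IsSelfAdjoint b) : b - (x : ℂ) • 1 = cfc (fun y : ℝ => y - x) b := by
  rw [cfc_sub _ _ b (by fun_prop) (by fun_prop), cfc_id' ℝ b, cfc_const x b,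
    Algebra.algebraMap_eq_smul_one, Complex.coe_smul]

/-- The defect E = 1 - R(b - x) satisfies (b - x)E = 0, so its range lies in the eigenspace, and E
fixes the eigenspace. Being self-adjoint, it is the eigenprojection. -/
lemma redRes_mul_sub (hδ : 0 < δ) (hb : IsSelfAdjoint b) (hg : IsGap δ x b) :
    redRes δ x b * (b - (x : ℂ) • 1) = 1 - eigenProj b x := by
  have hc := continuous_redFun hδ x
  set R := redRes δ x b with hR
  set E := 1 - R * (b - (x : ℂ) • 1) with hE
  have hE1 : E = cfc (fun y => 1 - redFun δ x y * (y - x)) b := by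
    rw [cfc_sub _ _ b (by fun_prop) (by fun_prop), cfc_mul _ _ b (by fun_prop) (by fun_prop),
      ← sub_smul_eq_cfc hb, cfc_const_one ℝ b, hE, hR, redRes]
  have h1 : (b - (x : ℂ) • 1) * E = 0 := by
    rw [hE1, sub_smul_eq_cfc hb, ← cfc_mul _ _ b (by fun_prop) (by fun_prop), ← cfc_zero ℝ b]
    refine cfc_congr fun y hy => ?_
    rcases hg y hy with rfl | h
    · simp
    · have h0 : y - x ≠ 0 := abs_pos.1 (hδ.trans_le h)
      simp [redFun_of_le hδ h, h0]
  have h2 : eigenProj b x * E = E := by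
    refine eigenProj_mul_of_eigen ?_
    rwa [sub_mul, smul_mul_assoc, one_mul, sub_eq_zero] at h1
  have h3 : E * eigenProj b x = eigenProj b x := by
    rw [hE, sub_mul, one_mul, mul_assoc, sub_mul, mul_eigenProj, smul_mul_assoc, one_mul, sub_self,
      mul_zero, sub_zero]
  have h4 : star E = E := by rw [hE1]; exact IsSelfAdjoint.star_eq (cfc_predicate (R := ℝ) _ b)
  have h5 := congrArg star h3
  rw [star_mul, h4, star_eigenProj, h2] at h5
  rw [← h5, hE]; abel

lemma sub_mul_redRes (hδ : 0 < δ) (hb : IsSelfAdjoint b) (hg : IsGap δ x b) :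
    (b - (x : ℂ) • 1) * redRes δ x b = 1 - eigenProj b x := by
  have := congrArg star (redRes_mul_sub hδ hb hg)
  simpa [star_redRes, star_eigenProj, hb.star_eq] using this

/-- Perturbation formula for spectral projections. -/
lemma eigenProj_sub_eigenProj {c : H →L[ℂ] H} (hδ : 0 < δ) (hb : IsSelfAdjoint b)
    (hc : IsSelfAdjoint c) (hgb : IsGap δ x b) (hgc : IsGap δ x c) :
    eigenProj c x - eigenProj b x =
      -(eigenProj c x * (c - b) * redRes δ x b) - redRes δ x c * (c - b) * eigenProj b x := by
  -- With this splitting p(c) kills c - x from the left and p(b) kills b - x from the right; the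
  -- reduced resolvents invert what remains.
  have e : c - b = (c - (x : ℂ) • 1) - (b - (x : ℂ) • 1) := by abel
  have h1 : eigenProj c x * (c - (x : ℂ) • 1) = 0 := by
    rw [mul_sub, eigenProj_mul hc, mul_smul_comm, mul_one, sub_self]
  have h2 : (b - (x : ℂ) • 1) * eigenProj b x = 0 := by
    rw [sub_mul, mul_eigenProj, smul_mul_assoc, one_mul, sub_self]
  have h3 : eigenProj c x * (c - b) * redRes δ x b = -(eigenProj c x * (1 - eigenProj b x)) := by
    rw [e, mul_sub, h1, zero_sub, neg_mul, mul_assoc, sub_mul_redRes hδ hb hgb]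
  have h4 : redRes δ x c * (c - b) * eigenProj b x = (1 - eigenProj c x) * eigenProj b x := by
    rw [e, mul_assoc, sub_mul, h2, sub_zero, ← mul_assoc, redRes_mul_sub hδ hc hgc]
  rw [h3, h4]
  noncomm_ring

/-- Perturbation formula for reduced resolvents. -/
lemma redRes_sub_redRes {c : H →L[ℂ] H} (hδ : 0 < δ) (hb : IsSelfAdjoint b)
    (hc : IsSelfAdjoint c) (hgb : IsGap δ x b) (hgc : IsGap δ x c) :
    redRes δ x c - redRes δ x b = -((redRes δ x c + eigenProj c x) *
      (c - b + (eigenProj c x - eigenProj b x)) * (redRes δ x b + eigenProj b x)) -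
        (eigenProj c x - eigenProj b x) := by
  -- Adding the projection makes c - x invertible, with inverse R + p, so the second resolvent
  -- identity becomes available.
  have h1 : (redRes δ x c + eigenProj c x) * (c - (x : ℂ) • 1 + eigenProj c x) = 1 := by
    rw [add_mul, mul_add, mul_add, redRes_mul_sub hδ hc hgc, redRes_mul_eigenProj hδ hc,
      eigenProj_mul_self, mul_sub, eigenProj_mul hc, mul_smul_comm, mul_one, sub_self]
    abel
  have h2 : (b - (x : ℂ) • 1 + eigenProj b x) * (redRes δ x b + eigenProj b x) = 1 := by
    rw [add_mul, mul_add, mul_add, sub_mul_redRes hδ hb hgb, eigenProj_mul_redRes hδ hb,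
      eigenProj_mul_self, sub_mul, mul_eigenProj, smul_mul_assoc, one_mul, sub_self]
    abel
  have e : c - b + (eigenProj c x - eigenProj b x) =
      (c - (x : ℂ) • 1 + eigenProj c x) - (b - (x : ℂ) • 1 + eigenProj b x) := by abel
  rw [e, mul_sub, h1, sub_mul, one_mul, mul_assoc, h2]
  noncomm_ring

lemma mem_eigenProj (hx : x ≠ 0) (hm : Mem 1 b) : Mem 1 (eigenProj b x) := by
  have h := (hm.mul_right (eigenProj b x)).smul ((x : ℂ)⁻¹)
  rwa [mul_eigenProj, smul_smul, inv_mul_cancel₀ (by exact_mod_cast hx), one_smul] at h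

/-- Spectral projections of a `C¹` curve of trace class operators with a uniform spectral gap. -/
lemma isC1In_eigenProj {b b' : ℝ → H →L[ℂ] H} (hC : IsC1In 1 b b')
    (hb : ∀ t, IsSelfAdjoint (b t)) (hcont : Continuous b) (hx : x ≠ 0) (hδ : 0 < δ)
    (hg : ∀ t, IsGap δ x (b t)) :
    IsC1In 1 (fun t => eigenProj (b t) x) (fun t =>
      -(eigenProj (b t) x * b' t * redRes δ x (b t)) -
        redRes δ x (b t) * b' t * eigenProj (b t) x) := by
  -- Lipschitz bounds in operator norm suffice for p and R, since in every product the increment of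
  -- b carries the trace norm.
  have hdist : ∀ s t, ‖eigenProj (b s) x - eigenProj (b t) x‖ ≤ 2 * δ⁻¹ * ‖b s - b t‖ := by
    intro s t
    rw [eigenProj_sub_eigenProj hδ (hb t) (hb s) (hg t) (hg s)]
    refine (norm_sub_le _ _).trans ?_
    rw [norm_neg]
    have h1 : ‖eigenProj (b s) x * (b s - b t) * redRes δ x (b t)‖ ≤ 1 * ‖b s - b t‖ * δ⁻¹ := by
      refine (norm_mul_le _ _).trans ?_
      gcongr
      · refine (norm_mul_le _ _).trans ?_
        gcongr
        exact norm_eigenProj_le _ _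
      · exact norm_redRes_le hδ (hg t)
    have h2 : ‖redRes δ x (b s) * (b s - b t) * eigenProj (b t) x‖ ≤ δ⁻¹ * ‖b s - b t‖ * 1 := by
      refine (norm_mul_le _ _).trans ?_
      gcongr
      · refine (norm_mul_le _ _).trans ?_
        gcongr
        exact norm_redRes_le hδ (hg s)
      · exact norm_eigenProj_le _ _
    linarith
  have hb0 : ∀ t, Tendsto (fun s => ‖b s - b t‖) (𝓝 t) (𝓝 0) := fun t =>
    tendsto_iff_norm_sub_tendsto_zero.1 (hcont.tendsto t)
  have hpc : ∀ t, Tendsto (fun s => eigenProj (b s) x) (𝓝 t) (𝓝 (eigenProj (b t) x)) := by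
    intro t
    rw [tendsto_iff_norm_sub_tendsto_zero]
    refine squeeze_zero (fun _ => norm_nonneg _) (fun s => hdist s t) ?_
    simpa using (hb0 t).const_mul (2 * δ⁻¹)
  have hRc : ∀ t, Tendsto (fun s => redRes δ x (b s)) (𝓝 t) (𝓝 (redRes δ x (b t))) := by
    intro t
    rw [tendsto_iff_norm_sub_tendsto_zero]
    have hbd : ∀ s, ‖redRes δ x (b s) + eigenProj (b s) x‖ ≤ δ⁻¹ + 1 := fun s =>
      (norm_add_le _ _).trans (add_le_add (norm_redRes_le hδ (hg s)) (norm_eigenProj_le _ _))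
    refine squeeze_zero (g := fun s => (δ⁻¹ + 1) * (‖b s - b t‖ + 2 * δ⁻¹ * ‖b s - b t‖) * (δ⁻¹ + 1)
      + 2 * δ⁻¹ * ‖b s - b t‖) (fun _ => norm_nonneg _) (fun s => ?_) ?_
    · rw [redRes_sub_redRes hδ (hb t) (hb s) (hg t) (hg s)]
      refine (norm_sub_le _ _).trans (add_le_add ?_ (hdist s t))
      rw [norm_neg]
      refine (norm_mul_le _ _).trans ?_
      gcongr
      · refine (norm_mul_le _ _).trans ?_
        gcongr
        · exact hbd s
        · exact (norm_add_le _ _).trans (add_le_add le_rfl (hdist s t))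
      · exact hbd t
    · have h1 := (hb0 t).const_mul (2 * δ⁻¹)
      have h2 := ((((hb0 t).add h1).const_mul (δ⁻¹ + 1)).mul_const (δ⁻¹ + 1)).add h1
      simpa using h2
  have hm : ∀ t, Mem 1 (eigenProj (b t) x) := fun t => mem_eigenProj hx (hC.1 t)
  refine ⟨hm, fun t => ?_, fun t => ?_, fun t => ?_⟩
  · exact (((hC.2.1 t).mul_left _).mul_right _).neg.sub (((hC.2.1 t).mul_left _).mul_right _)
  · have hd : TendstoTr (fun s => (((s - t)⁻¹ : ℝ) : ℂ) • (b s - b t)) (𝓝[≠] t) (b' t) := hC.2.2.1 t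
    have hm' := hC.2.1 t
    have h1 := (hd.mul_left hm' ((hpc t).mono_left nhdsWithin_le_nhds)).mul_right
      (hm'.mul_left _) (tendsto_const_nhds (x := redRes δ x (b t)))
    have h2 := (hd.mul_left hm' ((hRc t).mono_left nhdsWithin_le_nhds)).mul_right
      (hm'.mul_left _) (tendsto_const_nhds (x := eigenProj (b t) x))
    refine Tendsto.congr (fun s => ?_) (h1.neg.sub h2)
    congr 2
    rw [eigenProj_sub_eigenProj hδ (hb t) (hb s) (hg t) (hg s)]
    simp only [mul_smul_comm, smul_mul_assoc, ← smul_neg, ← smul_sub]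
  · have hd : TendstoTr b' (𝓝 t) (b' t) := hC.2.2.2 t
    have hm' := hC.2.1 t
    have h1 := (hd.mul_left hm' (hpc t)).mul_right (hm'.mul_left _) (hRc t)
    have h2 := (hd.mul_left hm' (hRc t)).mul_right (hm'.mul_left _) (hpc t)
    exact h1.neg.sub h2

/-- Nonzero points of the spectrum of a compact positive operator are isolated. -/
lemma exists_isGap (hc : IsCompactOperator b) (hb : IsSelfAdjoint b) (hx : 0 < x) :
    ∃ δ, 0 < δ ∧ δ ≤ x ∧ IsGap δ x b := by
  have hx' : (x : ℂ) ≠ 0 := by exact_mod_cast hx.ne'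
  set p := eigenProj b x with hp
  have hpc : IsCompactOperator p := by
    have h1 : p = (x : ℂ)⁻¹ • (b * p) := by
      rw [mul_eigenProj, smul_smul, inv_mul_cancel₀ hx', one_smul]
    rw [h1]
    exact (hc.comp_clm p).smul ((x : ℂ)⁻¹)
  have hcc : IsCompactOperator (b + p) := hc.add hpc
  -- Adding p shifts the eigenvalue x to x + 1 and leaves the other eigenspaces alone, so x enters
  -- the resolvent set of the compact operator b + p, which is open.
  have h1 : ¬ Module.End.HasEigenvalue (b + p).toLinearMap (x : ℂ) := by
    intro h
    obtain ⟨ξ, hξ⟩ := h.exists_hasEigenvector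
    have h2 : b ξ + p ξ = (x : ℂ) • ξ := hξ.apply_eq_smul
    have h3 : p (b ξ) = (x : ℂ) • p ξ := congr($(eigenProj_mul hb x) ξ)
    have h4 : p (p ξ) = p ξ := congr($(eigenProj_mul_self b x) ξ)
    have h5 := congrArg p h2
    rw [map_add, h3, h4, map_smul, add_eq_left] at h5
    rw [h5, add_zero] at h2
    exact hξ.2 ((eigenProj_apply_eq_self_iff.2 h2).symm.trans h5)
  have h2 := (hcc.hasEigenvalue_or_mem_resolventSet hx').resolve_left h1
  obtain ⟨ε, hε, hball⟩ := Metric.isOpen_iff.1 (spectrum.isOpen_resolventSet (𝕜 := ℂ) (b + p)) _ h2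
  -- The bound δ ≤ x also separates x from the point 0, where the spectrum may accumulate.
  refine ⟨min ε x, by positivity, min_le_right _ _, fun y hy => ?_⟩
  by_contra! hcon
  obtain ⟨hyx, hlt⟩ := hcon
  have hy0 : y ≠ 0 := by
    rintro rfl
    have := hlt.trans_le (min_le_right _ _)
    rw [zero_sub, abs_neg, abs_of_pos hx] at this
    exact lt_irrefl _ this
  rw [mem_spectrum_real_iff, ← hc.hasEigenvalue_iff_mem_spectrum (by exact_mod_cast hy0),
    hasEigenvalue_iff_eigenProj_ne_zero] at hy
  have h3 : (y : ℂ) ∈ resolventSet ℂ (b + p) := by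
    apply hball
    rw [Metric.mem_ball, Complex.dist_eq, ← Complex.ofReal_sub, Complex.norm_real]
    exact hlt.trans_le (min_le_left _ _)
  rw [spectrum.mem_resolventSet_iff] at h3
  have h4 : (algebraMap ℂ (H →L[ℂ] H) y - (b + p)) * eigenProj b y = 0 := by
    rw [sub_mul, add_mul, mul_eigenProj, hp, eigenProj_mul_eigenProj hb (Ne.symm hyx),
      Algebra.algebraMap_eq_smul_one, smul_mul_assoc, one_mul, add_zero, sub_self]
  exact hy ((h3.mul_right_eq_zero).1 h4)

end ReducedResolvent

/-! ### Orthogonal families of projections and the spectral decomposition -/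

lemma norm_le_one_of_proj {Q : H →L[ℂ] H} (hs' : star Q = Q) (hi : Q * Q = Q) : ‖Q‖ ≤ 1 :=
  IsStarProjection.norm_le Q ⟨hi, hs'⟩

lemma sum_proj_mul_sum_proj {ι : Type*} {p : ι → H →L[ℂ] H} (hi : ∀ i, p i * p i = p i)
    (ho : ∀ i j, i ≠ j → p i * p j = 0) (F : Finset ι) :
    (∑ i ∈ F, p i) * ∑ i ∈ F, p i = ∑ i ∈ F, p i := by
  classical
  rw [Finset.sum_mul_sum]
  refine Finset.sum_congr rfl fun i hiF => ?_
  rw [Finset.sum_eq_single i (fun j _ hj => ho i j hj.symm) (fun h => absurd hiF h), hi]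

lemma enorm_sum_proj_sq {ι : Type*} {p : ι → H →L[ℂ] H} (hsa : ∀ i, star (p i) = p i)
    (ho : ∀ i j, i ≠ j → p i * p j = 0) (F : Finset ι) (v : ι → H) :
    ‖∑ i ∈ F, p i (v i)‖ₑ ^ 2 = ∑ i ∈ F, ‖p i (v i)‖ₑ ^ 2 := by
  classical
  induction F using Finset.induction_on with
  | empty => simp
  | insert a F ha ih =>
    rw [Finset.sum_insert ha, Finset.sum_insert ha, ← ih, enorm_sq_eq_ofReal, enorm_sq_eq_ofReal,
      enorm_sq_eq_ofReal, ← ENNReal.ofReal_add (by positivity) (by positivity)]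
    congr 1
    have h0 : inner ℂ (p a (v a)) (∑ i ∈ F, p i (v i)) = 0 := by
      rw [inner_sum]
      refine Finset.sum_eq_zero fun i hi => ?_
      have hne : a ≠ i := fun h => ha (h ▸ hi)
      rw [← hsa a, ContinuousLinearMap.star_eq_adjoint, ContinuousLinearMap.adjoint_inner_left,
        ← mul_apply_eq_comp, ho a i hne]
      simp
    have := norm_add_sq_eq_norm_sq_add_norm_sq_of_inner_eq_zero _ _ h0
    simpa [sq] using this

/-- Pythagoras on each basis vector. Different right factors X i can then be estimated termwise,
with no constant depending on F. -/
lemma hs_sum_proj {ι : Type*} {p : ι → H →L[ℂ] H} (hsa : ∀ i, star (p i) = p i)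
    (ho : ∀ i j, i ≠ j → p i * p j = 0) (F : Finset ι) (X : ι → H →L[ℂ] H) :
    hs (∑ i ∈ F, p i * X i) = ∑ i ∈ F, hs (p i * X i) := by
  simp only [hs]
  rw [← Summable.tsum_finsetSum fun _ _ => ENNReal.summable]
  refine tsum_congr fun j => ?_
  have := enorm_sum_proj_sq hsa ho F (fun i => X i (stdBasis H j))
  simpa [sum_apply] using this

/-- `b` is a compact positive operator with positive eigenvalues `lam`. -/
structure EigenSystem {ι : Type*} (b : H →L[ℂ] H) (lam : ι → ℝ) : Prop where
  nonneg : 0 ≤ b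
  compact : IsCompactOperator b
  injective : Function.Injective lam
  mem_range : ∀ x : ℝ, x ∈ Set.range lam ↔
    0 < x ∧ Module.End.HasEigenvalue b.toLinearMap (x : ℂ)

namespace EigenSystem

variable {ι : Type*} {b : H →L[ℂ] H} {lam : ι → ℝ}

lemma isSelfAdjoint (h : EigenSystem b lam) : IsSelfAdjoint b := h.nonneg.isSelfAdjoint

lemma pos (h : EigenSystem b lam) (i : ι) : 0 < lam i := ((h.mem_range _).1 ⟨i, rfl⟩).1

lemma proj_mul_proj (h : EigenSystem b lam) {i j : ι} (hij : i ≠ j) :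
    eigenProj b (lam i) * eigenProj b (lam j) = 0 :=
  eigenProj_mul_eigenProj h.isSelfAdjoint (h.injective.ne hij)

lemma proj_mul_kerProj (h : EigenSystem b lam) (i : ι) :
    eigenProj b (lam i) * eigenProj b 0 = 0 :=
  eigenProj_mul_eigenProj h.isSelfAdjoint (h.pos i).ne'

lemma kerProj_mul_proj (h : EigenSystem b lam) (i : ι) :
    eigenProj b 0 * eigenProj b (lam i) = 0 :=
  eigenProj_mul_eigenProj h.isSelfAdjoint (h.pos i).ne

end EigenSystem

/-- The projection onto the orthogonal complement of the kernel of `b` and the eigenspaces to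
`lam i` with `i ∈ F`. -/
def tailProj {ι : Type*} (b : H →L[ℂ] H) (lam : ι → ℝ) (F : Finset ι) : H →L[ℂ] H :=
  1 - eigenProj b 0 - ∑ i ∈ F, eigenProj b (lam i)

namespace EigenSystem

variable {ι : Type*} {b : H →L[ℂ] H} {lam : ι → ℝ}

lemma star_tailProj (b : H →L[ℂ] H) (lam : ι → ℝ) (F : Finset ι) :
    star (tailProj b lam F) = tailProj b lam F := by
  simp [tailProj, star_eigenProj, star_sum]

lemma star_sum_proj (b : H →L[ℂ] H) (lam : ι → ℝ) (F : Finset ι) :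
    star (∑ i ∈ F, eigenProj b (lam i)) = ∑ i ∈ F, eigenProj b (lam i) := by
  simp [star_eigenProj, star_sum]

lemma sum_proj_mul_self (h : EigenSystem b lam) (F : Finset ι) :
    (∑ i ∈ F, eigenProj b (lam i)) * ∑ i ∈ F, eigenProj b (lam i) = ∑ i ∈ F, eigenProj b (lam i) :=
  sum_proj_mul_sum_proj (fun _ => eigenProj_mul_self _ _) (fun _ _ => h.proj_mul_proj) F

lemma norm_sum_proj_le (h : EigenSystem b lam) (F : Finset ι) :
    ‖∑ i ∈ F, eigenProj b (lam i)‖ ≤ 1 :=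
  norm_le_one_of_proj (star_sum_proj b lam F) (h.sum_proj_mul_self F)

lemma norm_tailProj_le (h : EigenSystem b lam) (F : Finset ι) : ‖tailProj b lam F‖ ≤ 1 := by
  refine norm_le_one_of_proj (star_tailProj b lam F) ?_
  have h1 : eigenProj b 0 * ∑ i ∈ F, eigenProj b (lam i) = 0 := by
    rw [Finset.mul_sum]; exact Finset.sum_eq_zero fun i _ => h.kerProj_mul_proj i
  have h2 : (∑ i ∈ F, eigenProj b (lam i)) * eigenProj b 0 = 0 := by
    rw [Finset.sum_mul]; exact Finset.sum_eq_zero fun i _ => h.proj_mul_kerProj i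
  have h3 := h.sum_proj_mul_self F
  have h4 := eigenProj_mul_self b 0
  rw [tailProj]
  simp only [sub_mul, mul_sub, one_mul, mul_one, h1, h2, h3, h4]
  abel

lemma tailProj_mul_proj (h : EigenSystem b lam) {F : Finset ι} {i : ι} (hi : i ∈ F) :
    tailProj b lam F * eigenProj b (lam i) = 0 := by
  rw [tailProj, sub_mul, sub_mul, one_mul, h.kerProj_mul_proj, Finset.sum_mul,
    Finset.sum_eq_single i (fun j _ hj => h.proj_mul_proj hj) (fun h' => absurd hi h'),
    eigenProj_mul_self]
  abel

lemma tailProj_mul_kerProj (h : EigenSystem b lam) (F : Finset ι) :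
    tailProj b lam F * eigenProj b 0 = 0 := by
  rw [tailProj, sub_mul, sub_mul, one_mul, eigenProj_mul_self, Finset.sum_mul,
    Finset.sum_eq_zero fun i _ => h.proj_mul_kerProj i]
  abel

/-- The tail projections converge strongly to zero. -/
lemma tendsto_tailProj (h : EigenSystem b lam) (ξ : H) :
    Tendsto (fun F => tailProj b lam F ξ) atTop (𝓝 0) := by
  classical
  -- V contains every eigenvector, so it is dense by the spectral theorem for compact self-adjoint
  -- operators; the bound ‖Q‖ ≤ 1 on the tail projections extends convergence to the closure.
  let V : Submodule ℂ H :=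
    { carrier := {ξ | Tendsto (fun F => tailProj b lam F ξ) atTop (𝓝 0)}
      add_mem' := fun {x y} hx hy => by
        have := Tendsto.add hx hy
        simpa using this
      zero_mem' := by simp
      smul_mem' := fun c x hx => by
        have := Tendsto.const_smul hx c
        simpa using this }
  have hsym : b.toLinearMap.IsSymmetric := h.isSelfAdjoint.isSymmetric
  have h1 : ⨆ μ, Module.End.eigenspace b.toLinearMap μ ≤ V := by
    refine iSup_le fun μ ξ hξ => ?_
    change Tendsto (fun F => tailProj b lam F ξ) atTop (𝓝 0)
    rw [Module.End.mem_eigenspace_iff] at hξ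
    by_cases hξ0 : ξ = 0
    · simp [hξ0]
    have hev : Module.End.HasEigenvalue b.toLinearMap μ :=
      Module.End.hasEigenvalue_of_hasEigenvector ⟨Module.End.mem_eigenspace_iff.2 hξ, hξ0⟩
    obtain ⟨x, rfl⟩ : ∃ x : ℝ, (x : ℂ) = μ := Complex.conj_eq_iff_real.1
      (hsym.conj_eigenvalue_eq_self hev) |>.imp fun _ h => h.symm
    have hx0 : 0 ≤ x := eigenvalue_nonneg_of_nonneg hev fun ζ =>
      ((ContinuousLinearMap.nonneg_iff_isPositive b).1 h.nonneg).re_inner_nonneg_right ζ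
    have hpξ : eigenProj b x ξ = ξ := eigenProj_apply_eq_self_iff.2 hξ
    rcases hx0.eq_or_lt with rfl | hx0
    · refine tendsto_const_nhds.congr fun F => ?_
      rw [← hpξ, ← mul_apply_eq_comp, h.tailProj_mul_kerProj]
      simp
    · obtain ⟨i, rfl⟩ := (h.mem_range x).2 ⟨hx0, hev⟩
      refine tendsto_const_nhds.congr' ?_
      filter_upwards [eventually_ge_atTop {i}] with F hF
      rw [← hpξ, ← mul_apply_eq_comp, h.tailProj_mul_proj (hF (by simp))]
      simp
  have h2 : Vᗮ = ⊥ := by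
    rw [eq_bot_iff, ← ContinuousLinearMap.orthogonalComplement_iSup_eigenspaces_eq_bot h.compact hsym]
    exact Submodule.orthogonal_le h1
  have h3 : V.topologicalClosure = ⊤ := (Submodule.topologicalClosure_eq_top_iff).2 h2
  have h4 : ξ ∈ closure (V : Set H) := by
    rw [← Submodule.topologicalClosure_coe, h3]; trivial
  rw [Metric.tendsto_nhds]
  intro ε hε
  obtain ⟨η, hηV, hη⟩ := Metric.mem_closure_iff.1 h4 (ε / 2) (by positivity)
  have h5 : Tendsto (fun F => tailProj b lam F η) atTop (𝓝 0) := hηV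
  filter_upwards [Metric.tendsto_nhds.1 h5 (ε / 2) (by positivity)] with F hF
  rw [dist_zero_right] at hF ⊢
  have e : tailProj b lam F ξ = tailProj b lam F (ξ - η) + tailProj b lam F η := by simp
  have h6 : ‖tailProj b lam F (ξ - η)‖ ≤ 1 * ‖ξ - η‖ :=
    (tailProj b lam F).le_of_opNorm_le (h.norm_tailProj_le F) _
  rw [e]
  rw [dist_eq_norm] at hη
  linarith [norm_add_le (tailProj b lam F (ξ - η)) (tailProj b lam F η)]

lemma tendsto_hs_tailProj_mul (h : EigenSystem b lam) {x : H →L[ℂ] H} (hx : hs x < ⊤) :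
    Tendsto (fun F => hs (tailProj b lam F * x)) atTop (𝓝 0) :=
  tendsto_hs_mul_of_strong h.norm_tailProj_le h.tendsto_tailProj hx

lemma tendsto_hs_mul_tailProj (h : EigenSystem b lam) {x : H →L[ℂ] H} (hx : hs x < ⊤) :
    Tendsto (fun F => hs (x * tailProj b lam F)) atTop (𝓝 0) := by
  refine (h.tendsto_hs_tailProj_mul (x := star x) (by rwa [hs_star])).congr fun F => ?_
  rw [← hs_star, star_mul, star_star, star_tailProj]

lemma kerProj_mul (h : EigenSystem b lam) : eigenProj b 0 * b = 0 := by
  rw [eigenProj_mul h.isSelfAdjoint]; simp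

/-- The spectral decomposition of `b`, in the trace class. -/
lemma hasSumIn_smul_proj {w : H →L[ℂ] H} (h : EigenSystem (star w * w) lam) (hw : hs w < ⊤) :
    HasSumIn 1 (fun i => (lam i : ℂ) • eigenProj (star w * w) (lam i)) (star w * w) := by
  have hw' : hs (star w) < ⊤ := by rwa [hs_star]
  have hm : Mem 1 (star w * w) := mem_mul_of_hs hw' hw
  refine ⟨fun i => (mem_eigenProj (h.pos i).ne' hm).smul _, hm, ?_⟩
  refine tendsto_zero_of_sq_le
    (tendsto_mul_zero tendsto_const_nhds hw.ne (h.tendsto_hs_tailProj_mul hw')) fun F => ?_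
  -- The kernel projection kills b, so the error is (Q w*) w up to sign, and Q w* tends to 0 in
  -- Hilbert-Schmidt norm.
  have e : ∑ i ∈ F, (lam i : ℂ) • eigenProj (star w * w) (lam i) - star w * w =
      -(tailProj (star w * w) lam F * star w * w) := by
    rw [mul_assoc, tailProj, sub_mul, sub_mul, h.kerProj_mul, Finset.sum_mul,
      Finset.sum_congr rfl fun i _ => eigenProj_mul h.isSelfAdjoint (lam i)]
    noncomm_ring
  rw [e, norm_one_neg, mul_comm (hs w)]
  exact norm_one_mul_sq_le _ _

end EigenSystem

/-! ### Divided differences and the coefficients γ -/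

section Multiplier

/-- The divided differences of `y ^ α` at `x`, applied to `b`. -/
def divDiff (α δ x : ℝ) (b : H →L[ℂ] H) : H →L[ℂ] H :=
  cfc (fun y : ℝ => (y ^ α - x ^ α) * redFun δ x y) b

variable {α δ x : ℝ} {b : H →L[ℂ] H}

lemma continuous_divDiff (hα : 0 < α) (hδ : 0 < δ) :
    Continuous fun y : ℝ => (y ^ α - x ^ α) * redFun δ x y :=
  ((Real.continuous_rpow_const hα.le).sub continuous_const).mul (continuous_redFun hδ x)

lemma star_divDiff : star (divDiff α δ x b) = divDiff α δ x b :=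
  IsSelfAdjoint.star_eq (cfc_predicate (R := ℝ) _ b)

lemma divDiff_mul_of_eigen (hα : 0 < α) (hδ : 0 < δ) (hb : IsSelfAdjoint b) {X : H →L[ℂ] H} {y : ℝ}
    (h : b * X = (y : ℂ) • X) (hy : δ ≤ |y - x|) :
    divDiff α δ x b * X = (((y ^ α - x ^ α) / (y - x) : ℝ) : ℂ) • X := by
  rw [divDiff, cfc_mul_of_eigen hb h (continuous_divDiff hα hδ), redFun_of_le hδ hy, div_eq_mul_inv]

lemma divDiff_mul_eigenProj_self (hα : 0 < α) (hδ : 0 < δ) (hb : IsSelfAdjoint b) :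
    divDiff α δ x b * eigenProj b x = 0 := by
  rw [divDiff, cfc_mul_of_eigen hb (mul_eigenProj b x) (continuous_divDiff hα hδ), redFun_self]
  simp

lemma divDiff_commute_eigenProj (hα : 0 < α) (hδ : 0 < δ) (hb : IsSelfAdjoint b) (y : ℝ) :
    divDiff α δ x b * eigenProj b y = eigenProj b y * divDiff α δ x b :=
  cfc_intertwine hb hb (by rw [mul_eigenProj, eigenProj_mul hb]) (continuous_divDiff hα hδ)

lemma divDiff_eq (hα : 0 < α) (hδ : 0 < δ) (hb : IsSelfAdjoint b) :
    divDiff α δ x b = (cfc (fun y : ℝ => y ^ α) b - ((x ^ α : ℝ) : ℂ) • 1) * redRes δ x b := by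
  have h1 : Continuous fun y : ℝ => y ^ α := Real.continuous_rpow_const hα.le
  have h2 := continuous_redFun hδ x
  rw [divDiff, cfc_mul (fun y : ℝ => y ^ α - x ^ α) _ b (by fun_prop) (by fun_prop),
    cfc_sub _ _ b (by fun_prop) (by fun_prop), cfc_const _ b,
    Algebra.algebraMap_eq_smul_one, Complex.coe_smul, redRes]

lemma divDiff_eq' (hα : 0 < α) (hδ : 0 < δ) (hb : IsSelfAdjoint b) :
    divDiff α δ x b = redRes δ x b * (cfc (fun y : ℝ => y ^ α) b - ((x ^ α : ℝ) : ℂ) • 1) := by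
  have h := congrArg star (divDiff_eq (x := x) hα hδ hb)
  have h2 : star (cfc (fun y : ℝ => y ^ α) b) = cfc (fun y : ℝ => y ^ α) b :=
    IsSelfAdjoint.star_eq (cfc_predicate (R := ℝ) _ b)
  simpa only [star_divDiff, star_mul, star_redRes, star_sub, h2, star_smul, star_one,
    Complex.star_def, Complex.conj_ofReal] using h

/-- For α ≤ 1 the function y^(α-1) decreases; the cases y ≥ x and y ≤ x follow by factoring out y
and x. Equality holds at y = 0, so the constant is sharp. -/
lemma abs_rpow_sub_rpow_le (hα : 0 < α) (hα1 : α ≤ 1) (hx : 0 < x) {y : ℝ} (hy : 0 ≤ y) :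
    |y ^ α - x ^ α| ≤ x ^ (α - 1) * |y - x| := by
  have e1 : x ^ α = x ^ (α - 1) * x := by
    rw [← Real.rpow_add_one hx.ne']; simp
  rcases le_total x y with h | h
  · have hy0 : 0 < y := hx.trans_le h
    have e2 : y ^ α = y ^ (α - 1) * y := by
      rw [← Real.rpow_add_one hy0.ne']; simp
    have h1 : y ^ (α - 1) ≤ x ^ (α - 1) :=
      Real.rpow_le_rpow_of_nonpos hx h (by linarith)
    rw [abs_of_nonneg (sub_nonneg.2 (by gcongr)), abs_of_nonneg (sub_nonneg.2 h), e1, e2]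
    nlinarith
  · have h1 : x ^ (α - 1) * y ≤ y ^ α := by
      rcases hy.eq_or_lt with rfl | hy0
      · simp [hα.ne']
      · have e2 : y ^ α = y ^ (α - 1) * y := by
          rw [← Real.rpow_add_one hy0.ne']; simp
        rw [e2]
        exact mul_le_mul_of_nonneg_right (Real.rpow_le_rpow_of_nonpos hy0 h (by linarith)) hy
    rw [abs_of_nonpos (sub_nonpos.2 (by gcongr)), abs_of_nonpos (sub_nonpos.2 h), e1]
    linarith

lemma norm_divDiff_le (hα : 0 < α) (hα1 : α ≤ 1) (hδ : 0 < δ) (hb : 0 ≤ b) (hx : 0 < x)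
    (hg : IsGap δ x b) : ‖divDiff α δ x b‖ ≤ x ^ (α - 1) := by
  refine norm_cfc_le (by positivity) fun y hy => ?_
  rcases hg y hy with rfl | h
  · rw [redFun_self, mul_zero, norm_zero]; positivity
  · have h0 : 0 < |y - x| := hδ.trans_le h
    rw [redFun_of_le hδ h, norm_mul, norm_inv, Real.norm_eq_abs, Real.norm_eq_abs,
      ← div_eq_mul_inv, div_le_iff₀ h0]
    exact abs_rpow_sub_rpow_le hα hα1 hx (spectrum_nonneg_of_nonneg hb hy)

/-- The derivative of a spectral projection, for `b' = [b ^ α, K]`. -/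
lemma eigenProj_deriv_eq (hα : 0 < α) (hδ : 0 < δ) (hb : IsSelfAdjoint b) (K : H →L[ℂ] H) :
    -(eigenProj b x * (cfc (fun y : ℝ => y ^ α) b * K - K * cfc (fun y : ℝ => y ^ α) b) *
        redRes δ x b) -
      redRes δ x b * (cfc (fun y : ℝ => y ^ α) b * K - K * cfc (fun y : ℝ => y ^ α) b) *
        eigenProj b x =
    eigenProj b x * K * divDiff α δ x b - divDiff α δ x b * K * eigenProj b x := by
  set a := cfc (fun y : ℝ => y ^ α) b with ha
  have h1 : a * eigenProj b x = ((x ^ α : ℝ) : ℂ) • eigenProj b x :=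
    cfc_mul_of_eigen hb (mul_eigenProj b x) (Real.continuous_rpow_const hα.le)
  have h2 : eigenProj b x * a = ((x ^ α : ℝ) : ℂ) • eigenProj b x := by
    rw [← h1]
    exact (cfc_intertwine hb hb (by rw [mul_eigenProj, eigenProj_mul hb])
      (Real.continuous_rpow_const hα.le)).symm
  have e1 : eigenProj b x * (a * K - K * a) * redRes δ x b =
      -(eigenProj b x * K * divDiff α δ x b) := by
    rw [divDiff_eq hα hδ hb, ← ha, mul_sub, ← mul_assoc, h2]
    simp only [sub_mul, mul_sub, smul_mul_assoc, mul_smul_comm, one_mul, mul_assoc]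
    abel
  have e2 : redRes δ x b * (a * K - K * a) * eigenProj b x =
      divDiff α δ x b * K * eigenProj b x := by
    rw [divDiff_eq' hα hδ hb, ← ha, mul_assoc, sub_mul, mul_assoc K, h1]
    simp only [sub_mul, mul_sub, smul_mul_assoc, mul_smul_comm, mul_one, mul_assoc]
  rw [e1, e2, neg_neg]

/-- The function `γ(x, ·)` of the equation for the spectral projections, applied to `b`. -/
def gamOp (α δ x : ℝ) (b : H →L[ℂ] H) : H →L[ℂ] H :=
  1 - eigenProj b x - ((x ^ (1 - α) : ℝ) : ℂ) • divDiff α δ x b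

lemma star_gamOp : star (gamOp α δ x b) = gamOp α δ x b := by
  simp only [gamOp, star_sub, star_one, star_smul, star_divDiff, star_eigenProj, Complex.star_def,
    Complex.conj_ofReal]

/-- Over the common denominator x - y the numerator is x^(1-α) y^α - y, that is (x^(1-α) - y^(1-α))
y^α. This is the origin of the coefficients γ. -/
lemma one_sub_eq_gam (hx : 0 < x) {y : ℝ} (hy : 0 < y) (hxy : y ≠ x) :
    1 - x ^ (1 - α) * ((y ^ α - x ^ α) / (y - x)) = gam α x y := by
  have h1 : x ^ (1 - α) * x ^ α = x := by rw [← Real.rpow_add hx]; simp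
  have h2 : y ^ (1 - α) * y ^ α = y := by rw [← Real.rpow_add hy]; simp
  have h3 : y - x ≠ 0 := sub_ne_zero.2 hxy
  have h4 : x - y ≠ 0 := sub_ne_zero.2 hxy.symm
  rw [gam]
  field_simp
  linear_combination (x - y) * h1 + (y - x) * h2

/-- Solve `gamOp` for the divided difference: D = x^(α-1) (1 - p - G). The two terms p K p cancel.
-/
lemma deriv_eq_smul (hx : 0 < x) (K : H →L[ℂ] H) :
    eigenProj b x * K * divDiff α δ x b - divDiff α δ x b * K * eigenProj b x =
      ((x ^ (α - 1) : ℝ) : ℂ) • ((eigenProj b x * K - K * eigenProj b x) -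
        (eigenProj b x * K * gamOp α δ x b - gamOp α δ x b * K * eigenProj b x)) := by
  have h1 : ((x ^ (α - 1) : ℝ) : ℂ) * ((x ^ (1 - α) : ℝ) : ℂ) = 1 := by
    rw [← Complex.ofReal_mul, ← Real.rpow_add hx]; simp
  have h2 : (eigenProj b x * K - K * eigenProj b x) -
        (eigenProj b x * K * gamOp α δ x b - gamOp α δ x b * K * eigenProj b x) =
      ((x ^ (1 - α) : ℝ) : ℂ) • (eigenProj b x * K * divDiff α δ x b -
        divDiff α δ x b * K * eigenProj b x) := by
    simp only [gamOp, mul_sub, sub_mul, mul_one, one_mul, mul_smul_comm, smul_mul_assoc, smul_sub,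
      mul_assoc]
    abel
  rw [h2, smul_smul, h1, one_smul]

end Multiplier

/-! ### The sum over l in the equation for p_i -/

namespace EigenSystem

variable {ι : Type*} {b : H →L[ℂ] H} {lam : ι → ℝ} {α : ℝ}

lemma le_abs_sub (h : EigenSystem b lam) {δ : ℝ} {i l : ι} (hg : IsGap δ (lam i) b) (hli : l ≠ i) :
    δ ≤ |lam l - lam i| := by
  have h1 := ((h.mem_range _).1 ⟨l, rfl⟩).2
  rw [h.compact.hasEigenvalue_iff_mem_spectrum (by exact_mod_cast (h.pos l).ne'),
    ← mem_spectrum_real_iff] at h1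
  exact (hg _ h1).resolve_left (h.injective.ne hli)

lemma divDiff_mul_proj (h : EigenSystem b lam) (hα : 0 < α) {δ : ℝ} (hδ : 0 < δ) {i l : ι}
    (hg : IsGap δ (lam i) b) (hli : l ≠ i) :
    divDiff α δ (lam i) b * eigenProj b (lam l) =
      (((lam l ^ α - lam i ^ α) / (lam l - lam i) : ℝ) : ℂ) • eigenProj b (lam l) :=
  divDiff_mul_of_eigen hα hδ h.isSelfAdjoint (mul_eigenProj _ _) (h.le_abs_sub hg hli)

lemma divDiff_mul_kerProj (h : EigenSystem b lam) (hα : 0 < α) {δ : ℝ} (hδ : 0 < δ) {i : ι}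
    (hδi : δ ≤ lam i) : divDiff α δ (lam i) b * eigenProj b 0 =
      ((lam i ^ (α - 1) : ℝ) : ℂ) • eigenProj b 0 := by
  have hi := h.pos i
  rw [divDiff_mul_of_eigen hα hδ h.isSelfAdjoint (mul_eigenProj _ _)
    (by rwa [zero_sub, abs_neg, abs_of_pos hi])]
  congr 2
  rw [Real.zero_rpow hα.ne', zero_sub, zero_sub, neg_div_neg_eq, Real.rpow_sub_one hi.ne']

lemma gamOp_mul_proj (h : EigenSystem b lam) (hα : 0 < α) {δ : ℝ} (hδ : 0 < δ) {i l : ι}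
    (hg : IsGap δ (lam i) b) (hli : l ≠ i) :
    gamOp α δ (lam i) b * eigenProj b (lam l) =
      ((gam α (lam i) (lam l) : ℝ) : ℂ) • eigenProj b (lam l) := by
  rw [gamOp, sub_mul, sub_mul, one_mul, h.proj_mul_proj hli.symm, smul_mul_assoc,
    h.divDiff_mul_proj hα hδ hg hli, ← one_sub_eq_gam (h.pos i) (h.pos l) (h.injective.ne hli),
    smul_smul, Complex.ofReal_sub, sub_smul, Complex.ofReal_one, one_smul, Complex.ofReal_mul,
    sub_zero]

lemma gamOp_mul_proj_self (h : EigenSystem b lam) (hα : 0 < α) {δ : ℝ} (hδ : 0 < δ) (i : ι) :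
    gamOp α δ (lam i) b * eigenProj b (lam i) = 0 := by
  rw [gamOp, sub_mul, sub_mul, one_mul, eigenProj_mul_self, smul_mul_assoc,
    divDiff_mul_eigenProj_self hα hδ h.isSelfAdjoint]
  simp

/-- At y = 0 the divided difference is x^(α-1), so 1 - x^(1-α) x^(α-1) = 0. Hence ker b needs no
term in the sum over l, even when it is infinite-dimensional. -/
lemma gamOp_mul_kerProj (h : EigenSystem b lam) (hα : 0 < α) {δ : ℝ} (hδ : 0 < δ) {i : ι}
    (hδi : δ ≤ lam i) : gamOp α δ (lam i) b * eigenProj b 0 = 0 := by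
  rw [gamOp, sub_mul, sub_mul, one_mul, h.proj_mul_kerProj, smul_mul_assoc,
    h.divDiff_mul_kerProj hα hδ hδi, smul_smul, ← Complex.ofReal_mul,
    ← Real.rpow_add (h.pos i)]
  simp

/-- Tail projections are indexed by finite sets of all eigenvalues, while the sum omits i; inserting
i makes the two nets comparable. -/
lemma tendsto_insert_map (i : ι) [DecidableEq ι] :
    Tendsto (fun F : Finset {l : ι // l ≠ i} => insert i (F.map (Function.Embedding.subtype _)))
      atTop atTop := by
  refine tendsto_atTop.2 fun s => ?_
  filter_upwards [eventually_ge_atTop (s.subtype (· ≠ i))] with F hF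
  intro l hl
  by_cases hli : l = i
  · simp [hli]
  · have : (⟨l, hli⟩ : {l : ι // l ≠ i}) ∈ F := hF (by simpa using hl)
    simp [hli, this]

/-- Convergence of the sum in the equation for the spectral projections. -/
lemma hasSumIn_gam (h : EigenSystem b lam) (hm : Mem 1 b) (hα : 0 < α) {δ : ℝ} (hδ : 0 < δ) {i : ι}
    (hδi : δ ≤ lam i) (hg : IsGap δ (lam i) b) {K : H →L[ℂ] H} (hK : hs K < ⊤)
    (hKs : star K = -K) :
    HasSumIn 1 (fun l : {l : ι // l ≠ i} => (gam α (lam i) (lam l) : ℂ) •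
        (eigenProj b (lam i) * K * eigenProj b (lam l) -
          eigenProj b (lam l) * K * eigenProj b (lam i)))
      (eigenProj b (lam i) * K * gamOp α δ (lam i) b -
        gamOp α δ (lam i) b * K * eigenProj b (lam i)) := by
  classical
  set p := eigenProj b (lam i) with hp
  set G := gamOp α δ (lam i) b with hG
  have hpm : Mem 1 p := mem_eigenProj (h.pos i).ne' hm
  have hphs : hs p < ⊤ := by
    have := hpm.anti one_pos one_le_two
    exact this.hs_lt_top
  refine ⟨fun l => (((hpm.mul_right K).mul_right _).sub (hpm.mul_left _)).smul _,
    ((hpm.mul_right K).mul_right _).sub (hpm.mul_left _), ?_⟩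
  -- Both p and K G are Hilbert-Schmidt, so cutting K G to the tail makes the product small in trace
  -- norm.
  have hX : TendstoTr (fun F => p * (K * G * tailProj b lam F)) atTop 0 := by
    refine tendsto_zero_of_sq_le (tendsto_mul_zero tendsto_const_nhds hphs.ne
      (h.tendsto_hs_mul_tailProj (hs_mul_lt_top' hK G))) fun F => ?_
    rw [sub_zero]
    exact norm_one_mul_sq_le _ _
  have hX2 := (hX.add hX.star).neg
  have hX3 := Tendsto.comp hX2 (tendsto_insert_map i)
  refine Tendsto.congr (fun F => ?_) hX3
  have hs1 : ∑ l ∈ F, (gam α (lam i) (lam l) : ℂ) • (p * K * eigenProj b (lam l) -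
      eigenProj b (lam l) * K * p) =
      p * K * (G * ∑ l ∈ F, eigenProj b (lam l)) - ((∑ l ∈ F, eigenProj b (lam l)) * G) * K * p := by
    rw [Finset.mul_sum, Finset.sum_mul, Finset.mul_sum, Finset.sum_mul, Finset.sum_mul,
      ← Finset.sum_sub_distrib]
    refine Finset.sum_congr rfl fun l _ => ?_
    have h1 := h.gamOp_mul_proj hα hδ hg l.2
    have h2 := congrArg star h1
    rw [star_mul, star_smul, star_eigenProj, star_gamOp, Complex.star_def, Complex.conj_ofReal] at h2
    rw [hG, h1, h2, smul_sub, mul_smul_comm, smul_mul_assoc, smul_mul_assoc]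
  have hs2 : ∑ l ∈ F, eigenProj b (lam l) =
      1 - eigenProj b 0 - p - tailProj b lam (insert i (F.map (Function.Embedding.subtype _))) := by
    rw [tailProj, Finset.sum_insert (by simp), Finset.sum_map]
    simp only [Function.Embedding.subtype_apply, hp]
    abel
  set Q := tailProj b lam (insert i (F.map (Function.Embedding.subtype _)))
  -- G annihilates p and the kernel projection, so the partial sum misses only G Q.
  have h1 : G * ∑ l ∈ F, eigenProj b (lam l) = G - G * Q := by
    rw [hs2, mul_sub, mul_sub, mul_sub, mul_one, hG, hp, h.gamOp_mul_kerProj hα hδ hδi,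
      h.gamOp_mul_proj_self hα hδ]
    simp
  have h2 := congrArg star h1
  rw [star_mul, star_sub, star_mul, star_sum, Finset.sum_congr rfl fun l _ => star_eigenProj b _,
    hG, star_gamOp, ← hG, star_tailProj] at h2
  simp only [Function.comp]
  congr 1
  rw [hs1, h1, h2, star_mul, star_mul, star_mul, star_tailProj, hKs, hp, star_eigenProj, ← hp, hG,
    star_gamOp, ← hG, star_zero]
  noncomm_ring

end EigenSystem

/-! ### Trace-norm convergence of ∑ λ_i p_i' -/

namespace EigenSystem

variable {ι : Type*} {b : H →L[ℂ] H} {lam : ι → ℝ} {α : ℝ}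

lemma rpow_mul_proj (h : EigenSystem b lam) (hα : 0 < α) (i : ι) :
    cfc (fun y : ℝ => y ^ α) b * eigenProj b (lam i) =
      ((lam i ^ α : ℝ) : ℂ) • eigenProj b (lam i) :=
  cfc_mul_of_eigen h.isSelfAdjoint (mul_eigenProj b _) (Real.continuous_rpow_const hα.le)

lemma proj_mul_rpow (h : EigenSystem b lam) (hα : 0 < α) (i : ι) :
    eigenProj b (lam i) * cfc (fun y : ℝ => y ^ α) b =
      ((lam i ^ α : ℝ) : ℂ) • eigenProj b (lam i) := by
  rw [← h.rpow_mul_proj hα]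
  exact (cfc_intertwine h.isSelfAdjoint h.isSelfAdjoint
    (by rw [mul_eigenProj, eigenProj_mul h.isSelfAdjoint])
    (Real.continuous_rpow_const hα.le)).symm

lemma kerProj_mul_rpow (h : EigenSystem b lam) (hα : 0 < α) :
    eigenProj b 0 * cfc (fun y : ℝ => y ^ α) b = 0 := by
  have h1 : cfc (fun y : ℝ => y ^ α) b * eigenProj b 0 = 0 := by
    rw [cfc_mul_of_eigen h.isSelfAdjoint (mul_eigenProj b _) (Real.continuous_rpow_const hα.le),
      Real.zero_rpow hα.ne']
    simp
  rw [← h1]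
  exact (cfc_intertwine h.isSelfAdjoint h.isSelfAdjoint
    (by rw [mul_eigenProj, eigenProj_mul h.isSelfAdjoint])
    (Real.continuous_rpow_const hα.le)).symm

/-- For l = i both sides vanish: the quotient is 0 / 0 = 0 by convention, which agrees with the
value of the divided difference operator on its own eigenspace. -/
lemma divDiff_mul_proj' (h : EigenSystem b lam) (hα : 0 < α) {δ : ℝ} (hδ : 0 < δ) {i : ι}
    (hg : IsGap δ (lam i) b) (l : ι) :
    divDiff α δ (lam i) b * eigenProj b (lam l) =
      (((lam l ^ α - lam i ^ α) / (lam l - lam i) : ℝ) : ℂ) • eigenProj b (lam l) := by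
  rcases eq_or_ne l i with rfl | hli
  · rw [divDiff_mul_eigenProj_self hα hδ h.isSelfAdjoint]; simp
  · exact h.divDiff_mul_proj hα hδ hg hli

lemma divDiff_mul_tailProj (h : EigenSystem b lam) (hα : 0 < α) {δ : ℝ} (hδ : 0 < δ) (x : ℝ)
    (F : Finset ι) :
    divDiff α δ x b * tailProj b lam F = tailProj b lam F * divDiff α δ x b := by
  simp only [tailProj, mul_sub, sub_mul, mul_one, one_mul, Finset.mul_sum, Finset.sum_mul,
    divDiff_commute_eigenProj hα hδ h.isSelfAdjoint]

variable {δ : ι → ℝ} {K : H →L[ℂ] H}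

/-- The part of `∑ λ_i p_i'` on the range of finitely many spectral projections. -/
lemma sum_smul_mul_sum_proj_add_star (h : EigenSystem b lam) (hα : 0 < α) (hδ : ∀ i, 0 < δ i)
    (hg : ∀ i, IsGap (δ i) (lam i) b) (hKs : star K = -K) (F : Finset ι) :
    (∑ i ∈ F, (lam i : ℂ) • (eigenProj b (lam i) * K * divDiff α (δ i) (lam i) b)) *
        ∑ l ∈ F, eigenProj b (lam l) +
      star ((∑ i ∈ F, (lam i : ℂ) • (eigenProj b (lam i) * K * divDiff α (δ i) (lam i) b)) *
        ∑ l ∈ F, eigenProj b (lam l)) =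
    (∑ i ∈ F, eigenProj b (lam i)) * cfc (fun y : ℝ => y ^ α) b * K *
        (∑ l ∈ F, eigenProj b (lam l)) +
      star ((∑ i ∈ F, eigenProj b (lam i)) * cfc (fun y : ℝ => y ^ α) b * K *
        (∑ l ∈ F, eigenProj b (lam l))) := by
  -- As K is skew-adjoint, adding the adjoint antisymmetrizes the coefficients.
  have key : ∀ c : ι → ι → ℝ,
      (∑ i ∈ F, ∑ l ∈ F, (c i l : ℂ) • (eigenProj b (lam i) * K * eigenProj b (lam l))) +
        star (∑ i ∈ F, ∑ l ∈ F, (c i l : ℂ) • (eigenProj b (lam i) * K * eigenProj b (lam l))) =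
      ∑ i ∈ F, ∑ l ∈ F, ((c i l - c l i : ℝ) : ℂ) •
        (eigenProj b (lam i) * K * eigenProj b (lam l)) := by
    intro c
    have h1 : star (∑ i ∈ F, ∑ l ∈ F, (c i l : ℂ) •
        (eigenProj b (lam i) * K * eigenProj b (lam l))) =
        -∑ i ∈ F, ∑ l ∈ F, (c l i : ℂ) • (eigenProj b (lam i) * K * eigenProj b (lam l)) := by
      rw [Finset.sum_comm]
      simp only [star_sum, star_smul, star_mul, star_eigenProj, hKs, Complex.star_def,
        Complex.conj_ofReal, ← Finset.sum_neg_distrib, neg_mul, mul_neg, smul_neg, mul_assoc]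
    rw [h1, ← sub_eq_add_neg, ← Finset.sum_sub_distrib]
    refine Finset.sum_congr rfl fun i _ => ?_
    rw [← Finset.sum_sub_distrib]
    refine Finset.sum_congr rfl fun l _ => ?_
    rw [Complex.ofReal_sub, sub_smul]
  have e1 : (∑ i ∈ F, (lam i : ℂ) • (eigenProj b (lam i) * K * divDiff α (δ i) (lam i) b)) *
        ∑ l ∈ F, eigenProj b (lam l) =
      ∑ i ∈ F, ∑ l ∈ F, ((lam i * ((lam l ^ α - lam i ^ α) / (lam l - lam i)) : ℝ) : ℂ) •
        (eigenProj b (lam i) * K * eigenProj b (lam l)) := by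
    rw [Finset.sum_mul_sum]
    refine Finset.sum_congr rfl fun i _ => Finset.sum_congr rfl fun l _ => ?_
    rw [smul_mul_assoc, mul_assoc, h.divDiff_mul_proj' hα (hδ i) (hg i), mul_smul_comm, smul_smul,
      ← Complex.ofReal_mul]
  have e2 : (∑ i ∈ F, eigenProj b (lam i)) * cfc (fun y : ℝ => y ^ α) b * K *
        (∑ l ∈ F, eigenProj b (lam l)) =
      ∑ i ∈ F, ∑ l ∈ F, ((lam i ^ α : ℝ) : ℂ) •
        (eigenProj b (lam i) * K * eigenProj b (lam l)) := by
    rw [Finset.sum_mul, Finset.sum_mul, Finset.sum_mul_sum]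
    refine Finset.sum_congr rfl fun i _ => Finset.sum_congr rfl fun l _ => ?_
    rw [h.proj_mul_rpow hα, smul_mul_assoc, smul_mul_assoc]
  -- The divided difference is symmetric in i and l, so antisymmetrizing λ_i times it gives λ_i^α -
  -- λ_l^α, the same as on the right.
  rw [e1, e2, key, key fun i _ => lam i ^ α]
  refine Finset.sum_congr rfl fun i _ => Finset.sum_congr rfl fun l _ => ?_
  congr 2
  rcases eq_or_ne i l with rfl | hil
  · simp
  · have h1 : lam l - lam i ≠ 0 := sub_ne_zero.2 (h.injective.ne hil.symm)
    have h2 : lam i - lam l ≠ 0 := sub_ne_zero.2 (h.injective.ne hil)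
    field_simp
    ring

/-- Hilbert-Schmidt bound for the off-diagonal part of `∑ λ_i p_i'`. -/
lemma hs_sum_proj_mul_tailProj_le (h : EigenSystem b lam) (hα : 0 < α) (hα1 : α ≤ 1)
    (hδ : ∀ i, 0 < δ i) (hg : ∀ i, IsGap (δ i) (lam i) b) (F : Finset ι) :
    hs (∑ i ∈ F, eigenProj b (lam i) * (((lam i ^ (1 - α) : ℝ) : ℂ) •
      (K * divDiff α (δ i) (lam i) b * tailProj b lam F))) ≤ hs (K * tailProj b lam F) := by
  have hsa : ∀ i, star (eigenProj b (lam i)) = eigenProj b (lam i) := fun i => star_eigenProj _ _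
  have ho : ∀ i j, i ≠ j → eigenProj b (lam i) * eigenProj b (lam j) = 0 := fun _ _ =>
    h.proj_mul_proj
  rw [hs_sum_proj hsa ho]
  calc _ ≤ ∑ i ∈ F, hs (eigenProj b (lam i) * (K * tailProj b lam F)) := by
        refine Finset.sum_le_sum fun i _ => ?_
        -- D_i commutes with the tail projection; moved to the far right, λ_i^(1-α) D_i is a
        -- contraction there.
        have e : eigenProj b (lam i) * (((lam i ^ (1 - α) : ℝ) : ℂ) •
            (K * divDiff α (δ i) (lam i) b * tailProj b lam F)) =
            eigenProj b (lam i) * (K * tailProj b lam F) *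
              (((lam i ^ (1 - α) : ℝ) : ℂ) • divDiff α (δ i) (lam i) b) := by
          rw [mul_assoc K, h.divDiff_mul_tailProj hα (hδ i), mul_smul_comm, mul_smul_comm]
          simp only [mul_assoc]
        rw [e]
        refine (hs_mul_le' _ _).trans (mul_le_of_le_one_right' (pow_le_one' ?_ 2))
        rw [← ofReal_norm]
        refine ENNReal.ofReal_le_one.2 ?_
        have hi := h.pos i
        rw [norm_smul, Complex.norm_real, Real.norm_of_nonneg (by positivity)]
        calc lam i ^ (1 - α) * ‖divDiff α (δ i) (lam i) b‖ ≤
              lam i ^ (1 - α) * lam i ^ (α - 1) := by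
              gcongr
              exact norm_divDiff_le hα hα1 (hδ i) h.nonneg hi (hg i)
          _ = 1 := by rw [← Real.rpow_add hi]; simp
    _ = hs ((∑ i ∈ F, eigenProj b (lam i)) * (K * tailProj b lam F)) := by
        rw [Finset.sum_mul, hs_sum_proj hsa ho]
    _ ≤ _ := by
        refine (hs_mul_le _ _).trans (mul_le_of_le_one_left' (pow_le_one' ?_ 2))
        rw [← ofReal_norm]
        exact ENNReal.ofReal_le_one.2 (h.norm_sum_proj_le F)

/-- The series `∑ λ_i p_i'` converges to `[b ^ α, K]` in the trace class. -/
lemma hasSumIn_smul_deriv (h : EigenSystem b lam) (hm : Mem 1 b) (hα : 0 < α) (hα1 : α ≤ 1)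
    (hδ : ∀ i, 0 < δ i) (hδl : ∀ i, δ i ≤ lam i) (hg : ∀ i, IsGap (δ i) (lam i) b)
    (ham : Mem 1 (cfc (fun y : ℝ => y ^ α) b)) (hK : hs K < ⊤) (hKs : star K = -K) :
    HasSumIn 1 (fun i => (lam i : ℂ) • (eigenProj b (lam i) * K * divDiff α (δ i) (lam i) b -
        divDiff α (δ i) (lam i) b * K * eigenProj b (lam i)))
      (cfc (fun y : ℝ => y ^ α) b * K - K * cfc (fun y : ℝ => y ^ α) b) := by
  have hpm : ∀ i, Mem 1 (eigenProj b (lam i)) := fun i => mem_eigenProj (h.pos i).ne' hm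
  refine ⟨fun i => ((((hpm i).mul_right K).mul_right _).sub ((hpm i).mul_left _)).smul _,
    (ham.mul_right K).sub (ham.mul_left K), ?_⟩
  have ha : hs (cfc (fun y : ℝ => y ^ α) b) < ⊤ := (ham.anti one_pos one_le_two).hs_lt_top
  have has : star (cfc (fun y : ℝ => y ^ α) b) = cfc (fun y : ℝ => y ^ α) b :=
    IsSelfAdjoint.star_eq (cfc_predicate (R := ℝ) _ b)
  -- From λ_i = λ_i^α λ_i^(1-α): the first power is pulled out as a left factor a, the second
  -- balances ‖D_i‖ ≤ λ_i^(α-1). Thus a Z is the tail block of the partial sum.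
  set Z : Finset ι → H →L[ℂ] H := fun F => ∑ i ∈ F, eigenProj b (lam i) *
    (((lam i ^ (1 - α) : ℝ) : ℂ) • (K * divDiff α (δ i) (lam i) b * tailProj b lam F)) with hZ
  have hpw := h.proj_mul_rpow hα
  have hpw' := h.rpow_mul_proj hα
  have hker := h.kerProj_mul_rpow hα
  have hdiag := h.sum_smul_mul_sum_proj_add_star hα hδ hg hKs
  set a := cfc (fun y : ℝ => y ^ α) b
  set Q := tailProj b lam with hQ
  have hKQ := h.tendsto_hs_mul_tailProj hK
  have hQa := h.tendsto_hs_tailProj_mul ha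
  have l1 : TendstoTr (fun F => a * (K * Q F)) atTop 0 :=
    tendsto_zero_of_sq_le (tendsto_mul_zero tendsto_const_nhds ha.ne hKQ) fun F => by
      rw [sub_zero]; exact norm_one_mul_sq_le _ _
  have l2 : TendstoTr (fun F => (Q F * a) * K) atTop 0 :=
    tendsto_zero_of_sq_le (tendsto_mul_zero tendsto_const_nhds hK.ne hQa) fun F => by
      rw [sub_zero, mul_comm (hs K)]; exact norm_one_mul_sq_le _ _
  have l3 : TendstoTr (fun F => (Q F * a) * (K * Q F)) atTop 0 :=
    tendsto_zero_of_sq_le (tendsto_mul_zero hQa (by simp) hKQ) fun F => by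
      rw [sub_zero]; exact norm_one_mul_sq_le _ _
  have l4 : TendstoTr (fun F => a * Z F) atTop 0 :=
    tendsto_zero_of_sq_le (tendsto_mul_zero tendsto_const_nhds ha.ne hKQ) fun F => by
      rw [sub_zero]
      refine (norm_one_mul_sq_le _ _).trans ?_
      gcongr
      exact h.hs_sum_proj_mul_tailProj_le hα hα1 hδ hg F
  have l5 := ((l3.sub l2).sub l1).add l4
  have l6 := l5.add l5.star
  simp only [sub_zero, add_zero, star_zero] at l6
  refine Tendsto.congr (fun F => ?_) l6
  rw [sub_zero]
  congr 1
  set P := ∑ i ∈ F, eigenProj b (lam i) with hP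
  set A := ∑ i ∈ F, (lam i : ℂ) • (eigenProj b (lam i) * K * divDiff α (δ i) (lam i) b) with hA
  have hsum : P + eigenProj b 0 = 1 - Q F := by
    rw [hQ, tailProj]; abel
  have hPa : P * a = a - Q F * a := by
    have : P = 1 - Q F - eigenProj b 0 := by rw [← hsum]; abel
    rw [this, sub_mul, hker, sub_mul, one_mul, sub_zero]
  have hA1 : ∑ i ∈ F, (lam i : ℂ) • (eigenProj b (lam i) * K * divDiff α (δ i) (lam i) b -
        divDiff α (δ i) (lam i) b * K * eigenProj b (lam i)) = A + star A := by
    rw [hA, star_sum, ← Finset.sum_add_distrib]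
    refine Finset.sum_congr rfl fun i _ => ?_
    rw [star_smul, star_mul, star_mul, star_divDiff, star_eigenProj, hKs, Complex.star_def,
      Complex.conj_ofReal, ← smul_add, neg_mul, mul_neg, ← sub_eq_add_neg, mul_assoc (divDiff _ _ _ _)]
  -- On ker b the operator D_i is λ_i^(α-1), and λ_i λ_i^(α-1) = λ_i^α is the eigenvalue of a.
  have hA2 : A * eigenProj b 0 = P * a * K * eigenProj b 0 := by
    rw [hA, hP, Finset.sum_mul, Finset.sum_mul, Finset.sum_mul, Finset.sum_mul]
    refine Finset.sum_congr rfl fun i _ => ?_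
    rw [smul_mul_assoc, mul_assoc, h.divDiff_mul_kerProj hα (hδ i) (hδl i), mul_smul_comm, smul_smul,
      hpw, smul_mul_assoc, smul_mul_assoc, ← Complex.ofReal_mul]
    congr 2
    rw [Real.rpow_sub_one (h.pos i).ne', mul_div_cancel₀ _ (h.pos i).ne']
  have hA3 : A * Q F = a * Z F := by
    rw [hA, hZ, Finset.sum_mul, Finset.mul_sum]
    refine Finset.sum_congr rfl fun i _ => ?_
    rw [← mul_assoc a, hpw', mul_smul_comm, smul_mul_assoc, smul_mul_assoc, smul_smul,
      ← Complex.ofReal_mul, ← Real.rpow_add (h.pos i)]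
    simp [mul_assoc]
  have hA4 : A = A * P + P * a * K * eigenProj b 0 + a * Z F := by
    rw [← hA2, ← hA3, ← mul_add, hsum, ← mul_add, sub_add_cancel, mul_one]
  -- The blocks on the chosen eigenspaces and on ker b combine to P a K (1 - Q), which differs from
  -- a K only by terms containing Q.
  have hD : P * a * K * P + P * a * K * eigenProj b 0 = (a - Q F * a) * K * (1 - Q F) := by
    rw [← mul_add, hsum, hPa]
  have e1 : A + star A = (A * P + star (A * P)) + (P * a * K * eigenProj b 0 + a * Z F) +
      star (P * a * K * eigenProj b 0 + a * Z F) := by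
    conv_lhs => rw [hA4]
    simp only [star_add]
    abel
  have e2 : A + star A = ((a - Q F * a) * K * (1 - Q F) + a * Z F) +
      star ((a - Q F * a) * K * (1 - Q F) + a * Z F) := by
    rw [e1, hdiag F, ← hD]
    simp only [star_add]
    abel
  have e3 : a * K - K * a = a * K + star (a * K) := by
    rw [star_mul, hKs, has, neg_mul, ← sub_eq_add_neg]
  have e4 : (a - Q F * a) * K * (1 - Q F) + a * Z F =
      (Q F * a * (K * Q F) - Q F * a * K - a * (K * Q F) + a * Z F) + a * K := by noncomm_ring
  rw [hA1, e2, e3, e4, star_add _ (a * K)]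
  abel

end EigenSystem

end Schatten

end

/-! ### Assembly -/

theorem mainTheorem12
    {H : Type*} [NormedAddCommGroup H] [InnerProductSpace ℂ H] [CompleteSpace H]
    [TopologicalSpace.SeparableSpace H]
    (n : ℕ) (hn : 1 ≤ n) (p q α : ℝ) (hp : p = 2 * n) (hpq : p.HolderConjugate q)
    (hα : α = q / 2)
    (w : ℝ → H →L[ℂ] H) (hw : Schatten.IsHamiltonSolution q w)
    (b : ℝ → H →L[ℂ] H) (hb : ∀ t, b t = star (w t) * w t)
    (K : H →L[ℂ] H) (hK : K = w 0 - star (w 0))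
    {ι : Type*} (lam : ι → ℝ) (hinj : Function.Injective lam)
    (hlam : ∀ x : ℝ, x ∈ Set.range lam ↔
      0 < x ∧ Module.End.HasEigenvalue (b 0).toLinearMap (x : ℂ))
    (P : ι → ℝ → H →L[ℂ] H) (hP : ∀ i t, P i t = Schatten.eigenProj (b t) (lam i)) :
    -- the spectral decomposition of `b t`, with eigenvalues independent of `t`
    (∀ t, Schatten.HasSumIn 1 (fun i => (lam i : ℂ) • P i t) (b t)) ∧
    ∃ (S dP : ι → ℝ → H →L[ℂ] H) (db : ℝ → H →L[ℂ] H),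
      -- convergence of the sum in the equation for the spectral projections
      (∀ i t, Schatten.HasSumIn q
        (fun l : {l : ι // l ≠ i} => (Schatten.gam α (lam i) (lam l) : ℂ) •
          (P i t * K * P l t - P l t * K * P i t)) (S i t)) ∧
      (∀ i t, Schatten.HasSumIn p
        (fun l : {l : ι // l ≠ i} => (Schatten.gam α (lam i) (lam l) : ℂ) •
          (P i t * K * P l t - P l t * K * P i t)) (S i t)) ∧
      -- the equation for the spectral projections
      (∀ i t, dP i t =
        ((lam i ^ (α - 1) : ℝ) : ℂ) • ((P i t * K - K * P i t) - S i t)) ∧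
      (∀ i, Schatten.IsC1In q (P i) (dP i)) ∧
      -- `b` is `C¹` in the trace class, with derivative `∑ λ_i p_i'`
      Schatten.IsC1In 1 b db ∧
      (∀ t, Schatten.HasSumIn 1 (fun i => (lam i : ℂ) • dP i t) (db t)) := by
  open Schatten in
  have hp2 : 2 ≤ p := by
    have : (1 : ℝ) ≤ n := by exact_mod_cast hn
    linarith
  have hq1 : 1 ≤ q := hpq.symm.lt.le
  have hq2 : q ≤ 2 := by
    have h1 := hpq.mul_eq_add
    nlinarith
  have hα0 : 0 < α := by rw [hα]; linarith
  have hα1 : α ≤ 1 := by rw [hα]; linarith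
  obtain rfl : b = fun t => star (w t) * w t := funext hb
  obtain rfl : P = fun i t => eigenProj (star (w t) * w t) (lam i) := by
    funext i t; exact hP i t
  beta_reduce at *
  have hwt := hw.hs_lt_top hq1 hq2
  have hwt' : ∀ t, hs (star (w t)) < ⊤ := fun t => by rw [hs_star]; exact hwt t
  have hKt : ∀ t, w t - star (w t) = K := fun t => by rw [hK]; exact hw.sub_star_eq hq1 hq2 t
  have hKhs : hs K < ⊤ := by rw [hK]; exact hs_sub_lt_top (hwt 0) (hwt' 0)
  have hKs : star K = -K := by rw [hK]; simp
  have hC := hw.isC1In_star_mul_self hq1 hq2 hKt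
  have hsys : ∀ t, EigenSystem (star (w t) * w t) lam := fun t =>
    { nonneg := star_mul_self_nonneg _
      compact := (isCompactOperator_of_hs (hwt t)).clm_comp (star (w t))
      injective := hinj
      mem_range := fun x => by
        rw [hlam]
        exact and_congr_right fun hx => hw.hasEigenvalue_iff hq1 hq2 hx 0 t }
  have hcont : Continuous fun t => star (w t) * w t :=
    continuous_iff_continuousAt.2 fun t => (hw.tendsto_star_mul_self hq1 hq2 t)
  choose δ hδ hδl hδg using fun i =>
    exists_isGap (hsys 0).compact (hsys 0).isSelfAdjoint ((hsys 0).pos i)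
  -- The gap chosen at time 0 serves all times: nonzero spectral points are eigenvalues, which do
  -- not move, and 0 is covered by δ i ≤ lam i.
  have hgap : ∀ i t, IsGap (δ i) (lam i) (star (w t) * w t) := by
    intro i t y hy
    have hy0 := spectrum_nonneg_of_nonneg (hsys t).nonneg hy
    rcases hy0.eq_or_lt with rfl | hy0
    · right
      rw [zero_sub, abs_neg, abs_of_pos ((hsys 0).pos i)]
      exact hδl i
    · have hyc : (y : ℂ) ≠ 0 := by exact_mod_cast hy0.ne'
      refine hδg i y ?_
      rw [mem_spectrum_real_iff, ← (hsys _).compact.hasEigenvalue_iff_mem_spectrum hyc] at hy ⊢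
      exact (hw.hasEigenvalue_iff hq1 hq2 hy0 0 t).2 hy
  have hacfc : ∀ t, absPow q (w t) = cfc (fun y : ℝ => y ^ α) (star (w t) * w t) := fun t => by
    rw [hα]; exact absPow_eq_cfc (by linarith) (w t)
  have ham : ∀ t, Mem 1 (cfc (fun y : ℝ => y ^ α) (star (w t) * w t)) := fun t => by
    rw [← hacfc]
    exact mem_one_of_trace_lt_top (absPow_nonneg q _) (hw.trace_lt_top hq1 t)
  simp only [hacfc] at hC
  have hsum := fun i t => (hsys t).hasSumIn_gam (hC.1 t) hα0 (hδ i) (hδl i) (hgap i t) hKhs hKs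
  refine ⟨fun t => (hsys t).hasSumIn_smul_proj (hwt t),
    fun i t => eigenProj (star (w t) * w t) (lam i) * K *
        gamOp α (δ i) (lam i) (star (w t) * w t) -
      gamOp α (δ i) (lam i) (star (w t) * w t) * K * eigenProj (star (w t) * w t) (lam i),
    fun i t => eigenProj (star (w t) * w t) (lam i) * K *
        divDiff α (δ i) (lam i) (star (w t) * w t) -
      divDiff α (δ i) (lam i) (star (w t) * w t) * K * eigenProj (star (w t) * w t) (lam i),
    fun t => cfc (fun y : ℝ => y ^ α) (star (w t) * w t) * K -
      K * cfc (fun y : ℝ => y ^ α) (star (w t) * w t),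
    fun i t => (hsum i t).anti one_pos hq1, fun i t => (hsum i t).anti one_pos (by linarith),
    fun i t => deriv_eq_smul ((hsys t).pos i) K, fun i => ?_, hC,
    fun t => (hsys t).hasSumIn_smul_deriv (hC.1 t) hα0 hα1 hδ hδl (fun i => hgap i t) (ham t)
      hKhs hKs⟩
  have h1 := isC1In_eigenProj hC (fun t => (hsys t).isSelfAdjoint) hcont ((hsys 0).pos i).ne' (hδ i)
    (hgap i)
  simp only [fun t => eigenProj_deriv_eq (x := lam i) hα0 (hδ i) (hsys t).isSelfAdjoint K] at h1
  exact h1.anti one_pos hq1
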